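/- Theorem (Approximate global symmetry). For real $a\le b$ write $[a,b]=\{n\in\mathbb Z: a\le n\le b\}$, and $[M]=\{n\in\mathbb Z:1\le n\le M\}$. For finite non-empty multisets $S,T$ of integers let $p_S(x)$ be the multiplicity of $x$ in $S$ divided by the cardinality $|S|$ (counted with multiplicity), let $$d_{TV}(S,T)=\sum_{x\in\mathbb Z}|p_S(x)-p_T(x)|,$$ let $S+T$ be the multiset of all sums $s+t$ ($s\in S$, $t\in T$, counted with multiplicity), and let $qS$ be the multiset of all $qs$, $s\in S$. Let $d,r\ge 1$ be natural numbers, and let $k\ge1$ be a natural number that is sufficiently large depending on $d,r$. Let $A$ be a real number that is sufficiently large depending on $d,r,k$. Let $M$ be a real number that is sufficiently large depending on $d,r,k,A$. For each $j=1,\dots,k$ let $P_j\in\mathbb Z[\mathrm h_1,\dots,\mathrm h_r]$ be a non-zero polynomial of (total) degree exactly $d-1$ whose coefficients are integers of magnitude at most $A$. For $\vec h=(\vec h_1,\dots,\vec h_k)\in(\mathbb Z^r)^k$ let $$Q(\vec h)=P_1(\vec h_1)[-M,M]+\dots+P_k(\vec h_k)[-M,M],\qquad Q_0=[-A^{-2k}M^d,\;A^{-2k}M^d],$$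 viewed as multisets of integers. Then $$\frac1{|([M]^r)^k|}\sum_{\vec h\in([M]^r)^k}\ \inf_{1\le q\le A^k} d_{TV}\bigl(Q(\vec h),\,Q(\vec h)+qQ_0\bigr)\ \le\ C\,A^{-1},$$ where $q$ ranges over natural numbers and the constant $C$ depends only on $d,r,k$. -/

import Mathlib

open scoped BigOperators

namespace GlobalSymmetry

/-- The density function of a finite multiset: the multiplicity of `x` divided by the
cardinality counted with multiplicity. -/
noncomputable def density {X : Type*} [DecidableEq X] (A : Multiset X) (x : X) : ℝ :=
  (A.count x : ℝ) / (Multiset.card A : ℝ)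

/-- The total variation distance (without a factor `1/2`): the sum over all `x` of the absolute
value of the difference of the two densities. Both densities vanish outside of the finite set over
which the sum is taken. -/
noncomputable def tvDist {X : Type*} [DecidableEq X] (A B : Multiset X) : ℝ :=
  ∑ x ∈ A.toFinset ∪ B.toFinset, |density A x - density B x|

/-- The sum multiset of all `a + b` with `a` in `A` and `b` in `B`, counted with multiplicity.
(Mathlib's `A + B` is the disjoint union.) -/
def sumMultiset {G : Type*} [Add G] (A B : Multiset G) : Multiset G :=
  (A ×ˢ B).map fun p => p.1 + p.2

/-- The dilate `q A`, the multiset of all `q * a` with `a` in `A`. -/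
def dilate (q : ℤ) (A : Multiset ℤ) : Multiset ℤ :=
  A.map fun a => q * a

/-- The discrete interval of all integers `n` with `a ≤ n ≤ b`, for real `a` and `b`. -/
noncomputable def interval (a b : ℝ) : Finset ℤ :=
  Finset.Icc ⌈a⌉ ⌊b⌋

theorem mem_interval {a b : ℝ} {n : ℤ} : n ∈ interval a b ↔ a ≤ n ∧ (n : ℝ) ≤ b := by
  simp [interval, Int.ceil_le, Int.le_floor]

/-- The generalised arithmetic progression `a₁ [-M, M] + ⋯ + a_k [-M, M]` as a multiset: the sums
`a₁ m₁ + ⋯ + a_k m_k`, one for each tuple `m` of integers in `[-M, M]`. -/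
noncomputable def progression {k : ℕ} (a : Fin k → ℤ) (M : ℝ) : Multiset ℤ :=
  (Fintype.piFinset fun _ : Fin k => interval (-M) M).val.map fun m => ∑ j, a j * m j

/-- The progression `Q(h) = P₁(h₁) [-M, M] + ⋯ + P_k(h_k) [-M, M]`. -/
noncomputable def polyProgression {r k : ℕ} (P : Fin k → MvPolynomial (Fin r) ℤ) (M : ℝ)
    (h : Fin k → Fin r → ℤ) : Multiset ℤ :=
  progression (fun j => MvPolynomial.eval (h j) (P j)) M

/-- The box `([M]^r)^k` with `[M] = {n ∈ ℤ : 1 ≤ n ≤ M}`. -/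
noncomputable def box (r k : ℕ) (M : ℝ) : Finset (Fin k → Fin r → ℤ) :=
  Fintype.piFinset fun _ => Fintype.piFinset fun _ => interval 1 M

end GlobalSymmetry

/-! Write a_j = P_j(h_j). By Cauchy–Schwarz and Plancherel on ℤ/N, with N exceeding twice every
element involved (`tvDist_sq_le`), the squared distance is at most the sum over θ = ξ/N of |Q̂(θ)|²
|Q̂₀(qθ) - 1|². Here Q̂(θ) is a product of k normalised Dirichlet kernels at the points a_j θ
(`charSum_progression`). Since the h_j are independent, the mean over h of |Q̂(θ)|² is a product of
k one-factor means (`sum_box_prod_le`).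

The engine is the Weyl-type estimate `exists_sum_dirichlet_sq_le`: a factor has mean square at most
CA/L unless some q ≤ L^C brings qθ within L^C/M^d of an integer. A larger mean would put αP(h) near
an integer for a dense set of h. Restricting to a line on which the top-degree part survives,
differencing down to degree 1 and using recurrence for linear phases (`exists_distInt_mul_le`) would
then give such a q.

Let K = L₀^C, with L₀ between (CA)² and A³. On the minor arcs the bound (CA/L)^k beats the number
O(A L^(3C)) of frequencies of level L once k is large, and summing over the levels L ≥ L₀ is
harmless (`sum_minorArcs_le`). On the major arcs θ is close to b/p in lowest terms with p ≤ K
(`norm_charSum_major_le`). If p divides every a_j, a suitable q is a multiple of p, so qθ is almost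
an integer and Q̂₀(qθ) is close to 1 because Q₀ is short. If p fails to divide some a_j, then a_j θ
stays away from the integers and Q̂(θ) is O(K/M).

One q ≤ K serves all such p if the a_j have no common divisor in (K, K²]: the largest common divisor
up to K is then a multiple of the others (`exists_dvd_of_forall_dvd`). The exceptional h are rare by
the same Weyl estimate, applied at θ = 1/l: a common divisor l makes every kernel there equal to 1,
although 1/l lies on the minor arcs (`card_common_divisor_le`). -/

namespace GlobalSymmetry

/-! ### Distance to the nearest integer. -/

/-- The distance from a real number to the nearest integer. -/
noncomputable def distInt (x : ℝ) : ℝ := |x - round x|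

theorem distInt_nonneg (x : ℝ) : 0 ≤ distInt x := abs_nonneg _

theorem distInt_le (x : ℝ) (n : ℤ) : distInt x ≤ |x - n| := round_le x n

theorem distInt_le_abs (x : ℝ) : distInt x ≤ |x| := by simpa using distInt_le x 0

theorem distInt_sub_le (x y : ℝ) : distInt (x - y) ≤ distInt x + distInt y := by
  refine (distInt_le _ (round x - round y)).trans ?_
  push_cast
  rw [show x - y - (round x - round y : ℝ) = (x - round x) - (y - round y) by ring]
  exact abs_sub _ _

theorem distInt_add_int (x : ℝ) (n : ℤ) : distInt (x + n) = distInt x := by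
  simp [distInt, round_add_intCast]

theorem distInt_int_mul_le (n : ℤ) (x : ℝ) : distInt (n * x) ≤ |(n : ℝ)| * distInt x := by
  refine (distInt_le _ (n * round x)).trans ?_
  push_cast
  rw [← mul_sub, abs_mul, distInt]

theorem distInt_nat_mul_le (n : ℕ) (x : ℝ) : distInt (n * x) ≤ n * distInt x := by
  simpa using distInt_int_mul_le n x

theorem distInt_eq_abs {x : ℝ} (hx : |x| ≤ 1 / 2) : distInt x = |x| := by
  refine le_antisymm (distInt_le_abs x) ?_
  rw [distInt]
  by_cases h : round x = 0
  · simp [h]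
  · have h1 : (1 : ℝ) ≤ |(round x : ℝ)| := by
      exact_mod_cast Int.one_le_abs h
    have h2 := abs_sub_abs_le_abs_sub (round x : ℝ) x
    rw [abs_sub_comm] at h2
    linarith

theorem inv_le_distInt_div {b : ℤ} {q : ℕ} (hq : 0 < q) (h : ¬ (q : ℤ) ∣ b) :
    1 / (q : ℝ) ≤ distInt (b / q) := by
  have hq' : (0 : ℝ) < q := by exact_mod_cast hq
  have h0 : b - q * round ((b : ℝ) / q) ≠ 0 := by
    intro h1
    exact h ⟨round ((b : ℝ) / q), by linarith⟩
  have h1 : (1 : ℝ) ≤ |(b : ℝ) - q * round ((b : ℝ) / q)| := by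
    exact_mod_cast Int.one_le_abs h0
  rw [distInt, div_le_iff₀ hq', ← abs_of_pos hq', ← abs_mul, abs_of_pos hq', sub_mul,
    div_mul_cancel₀ _ hq'.ne', mul_comm (round _ : ℝ)]
  exact h1

theorem nonempty_of_le_mul_card {S : Finset ℤ} {T : ℕ} {D : ℝ} (hT : 0 < T)
    (hcard : (T : ℝ) ≤ D * S.card) : S.Nonempty := by
  rw [Finset.nonempty_iff_ne_empty]
  rintro rfl
  simp at hcard
  omega

/-! ### Recurrence of linear phases on dense sets. -/

/-- A dense set of integers contains two elements whose difference is comparable to a prescribed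
length. -/
theorem exists_sub_mem_window {S : Finset ℤ} {T B : ℕ} {D : ℝ} (hD : 1 ≤ D)
    (hS : ∀ s ∈ S, -(T : ℤ) < s ∧ s < T) (hcard : (T : ℝ) ≤ D * S.card)
    (hB : 8 * D ≤ B) (hBT : B ≤ T) :
    ∃ n : ℕ, (B : ℝ) / (16 * D) ≤ n ∧ n ≤ B ∧ ∃ s ∈ S, ∃ t ∈ S, t - s = (n : ℤ) := by
  have hB0 : (0 : ℝ) < B := by linarith
  have hBpos : (0 : ℤ) < B := by exact_mod_cast hB0
  have hBT' : (B : ℝ) ≤ T := by exact_mod_cast hBT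
  -- Cut the line into blocks of length B. Without a difference in [B/(16D), B], each block holds at
  -- most B/(16D) + 1 elements of S, and at most 4T/B blocks matter. Since B ≥ 8D, the total is at
  -- most 3T/(4D), which is too few.
  by_contra! hcon
  have hmaps : ∀ s ∈ S, s / B ∈ Finset.Icc (-((T : ℤ) / B) - 1) ((T : ℤ) / B) := by
    intro s hs
    obtain ⟨h1, h2⟩ := hS s hs
    rw [Finset.mem_Icc]
    refine ⟨?_, Int.ediv_le_ediv hBpos h2.le⟩
    rw [Int.le_ediv_iff_mul_le hBpos]
    have := Int.lt_ediv_add_one_mul_self (T : ℤ) hBpos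
    nlinarith
  have hfib : ∀ w ∈ Finset.Icc (-((T : ℤ) / B) - 1) ((T : ℤ) / B),
      ((S.filter fun s => s / B = w).card : ℝ) ≤ B / (16 * D) + 1 := by
    intro w _
    rcases (S.filter fun s => s / B = w).eq_empty_or_nonempty with he | hne
    · rw [he]; simp; positivity
    set F := S.filter fun s => s / B = w with hF
    have hmin := F.min'_mem hne
    have hsub : F ⊆ Finset.Icc (F.min' hne) (F.min' hne + ⌊(B : ℝ) / (16 * D)⌋) := by
      intro t ht
      have hle := F.min'_le t ht
      rw [Finset.mem_Icc]
      refine ⟨hle, ?_⟩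
      have hmin' := Finset.mem_filter.1 hmin
      rw [hF, Finset.mem_filter] at ht
      obtain ⟨n, hn⟩ := Int.eq_ofNat_of_zero_le (sub_nonneg.2 hle)
      have hnB : n ≤ B := by
        have h1 := Int.lt_ediv_add_one_mul_self t hBpos
        have h2 := Int.ediv_mul_le (F.min' hne) hBpos.ne'
        rw [ht.2] at h1; rw [hmin'.2] at h2
        have : (n : ℤ) ≤ B := by rw [← hn]; linarith
        exact_mod_cast this
      have : (n : ℝ) < B / (16 * D) := by
        by_contra! h
        exact hcon n h hnB _ hmin'.1 _ ht.1 hn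
      have : (n : ℤ) ≤ ⌊(B : ℝ) / (16 * D)⌋ := Int.le_floor.2 (by exact_mod_cast this.le)
      linarith
    have hc := Finset.card_le_card hsub
    rw [Int.card_Icc] at hc
    have hfl : (0 : ℤ) ≤ ⌊(B : ℝ) / (16 * D)⌋ := Int.floor_nonneg.2 (by positivity)
    have h3 : (F.card : ℤ) ≤ ⌊(B : ℝ) / (16 * D)⌋ + 1 := by omega
    have h4 : (F.card : ℝ) ≤ (⌊(B : ℝ) / (16 * D)⌋ : ℝ) + 1 := by exact_mod_cast h3
    have := Int.floor_le ((B : ℝ) / (16 * D))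
    linarith
  have htot : (S.card : ℝ) ≤ (2 * (T / B : ℕ) + 2 : ℝ) * (B / (16 * D) + 1) := by
    rw [Finset.card_eq_sum_card_fiberwise hmaps]
    push_cast
    refine (Finset.sum_le_card_nsmul _ _ _ hfib).trans ?_
    rw [nsmul_eq_mul, Int.card_Icc]
    gcongr
    have : ((T : ℤ) / B + 1 - (-((T : ℤ) / B) - 1)).toNat = 2 * (T / B) + 2 := by
      have h : ((T : ℤ) / B) = ((T / B : ℕ) : ℤ) := by simp
      rw [h]; omega
    rw [this]; push_cast; rfl
  have hdiv : ((T / B : ℕ) : ℝ) ≤ T / B := Nat.cast_div_le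
  have h1 : (1 : ℝ) ≤ T / B := by rw [le_div_iff₀ hB0]; linarith
  have h2 : (S.card : ℝ) ≤ (4 * (T / B)) * (B / (16 * D) + 1) := by
    refine htot.trans ?_
    gcongr
    linarith
  have h3 : (4 * ((T : ℝ) / B)) * (B / (16 * D) + 1) = T / (4 * D) + 4 * T / B := by
    field_simp
    ring
  have h4 : 4 * (T : ℝ) / B ≤ T / (2 * D) := by
    rw [div_le_div_iff₀ hB0 (by positivity)]
    nlinarith [(Nat.cast_nonneg T : (0 : ℝ) ≤ T)]
  have h5 : (T : ℝ) ≤ D * (T / (4 * D) + T / (2 * D)) := by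
    refine hcard.trans ?_
    gcongr
    linarith
  have h6 : D * ((T : ℝ) / (4 * D) + T / (2 * D)) = 3 / 4 * T := by field_simp; ring
  linarith

/-- If the multiples of `θ` along a dense set of integers are all close to integers, then a bounded
multiple of `θ` is very close to an integer. -/
theorem exists_distInt_mul_le {S : Finset ℤ} {T : ℕ} {D η θ : ℝ} (hD : 1 ≤ D)
    (hS : ∀ s ∈ S, -(T : ℤ) < s ∧ s < T) (hcard : (T : ℝ) ≤ D * S.card)
    (hη : ∀ s ∈ S, distInt (θ * s) ≤ η) (hsmall : 2000 * D ^ 2 * η ≤ 1) (hT : 9 * D ≤ T) :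
    ∃ q : ℕ, 1 ≤ q ∧ (q : ℝ) ≤ 9 * D ∧ distInt (q * θ) ≤ 288 * D ^ 2 * η / T := by
  have hT0 : (0 : ℝ) < T := by linarith
  have hdiff : ∀ n : ℕ, (∃ s ∈ S, ∃ t ∈ S, t - s = (n : ℤ)) → distInt (n * θ) ≤ 2 * η := by
    rintro n ⟨s, hs, t, ht, hst⟩
    have h : (n : ℝ) * θ = θ * t - θ * s := by
      have : (n : ℝ) = t - s := by exact_mod_cast hst.symm
      rw [this]; ring
    rw [h]
    linarith [distInt_sub_le (θ * t) (θ * s), hη s hs, hη t ht]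
  have hη0 : 0 ≤ η := by
    obtain ⟨s, hs⟩ := nonempty_of_le_mul_card (by exact_mod_cast hT0) hcard
    exact (distInt_nonneg _).trans (hη s hs)
  have hceil : ((⌈8 * D⌉₊ : ℕ) : ℝ) ≤ 9 * D := by
    have := Nat.ceil_lt_add_one (show 0 ≤ 8 * D by linarith)
    linarith
  -- The shortest admissible window supplies the bounded multiplier q, so far only with error 2η.
  -- Longer windows then sharpen this error to O(η/T).
  obtain ⟨q, hq1, hq2, hqS⟩ := exists_sub_mem_window (B := ⌈8 * D⌉₊) hD hS hcard (Nat.le_ceil _)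
    (by exact_mod_cast hceil.trans hT)
  have hq9 : (q : ℝ) ≤ 9 * D := le_trans (by exact_mod_cast hq2) hceil
  have hqpos : 1 ≤ q := by
    have : (0 : ℝ) < q := lt_of_lt_of_le
      (div_pos (lt_of_lt_of_le (by linarith) (Nat.le_ceil (8 * D))) (by linarith)) hq1
    exact_mod_cast this
  refine ⟨q, hqpos, hq9, ?_⟩
  have hκ := hdiff q hqS
  rw [distInt] at hκ ⊢
  set κ := (q : ℝ) * θ - round ((q : ℝ) * θ) with hκdef
  rcases eq_or_ne κ 0 with h0 | h0
  · rw [h0, abs_zero]; positivity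
  have hκpos : 0 < |κ| := abs_pos.2 h0
  have hD2 : D ≤ D ^ 2 := by nlinarith
  have hκsmall : |κ| * (1000 * D ^ 2) ≤ 1 := by nlinarith
  have hDη : 1000 * D * |κ| ≤ 1 := by nlinarith
  -- As long as |κ|B ≤ 1/2, the multiples nκ with n ≤ B do not wrap around, so the distance of nκ to
  -- the integers is n|κ|. A difference n ≥ B/(16D) bounds this by 18Dη.
  have hkey : ∀ B : ℕ, 8 * D ≤ B → B ≤ T → |κ| * B ≤ 1 / 2 → |κ| * B ≤ 288 * D ^ 2 * η := by
    intro B hB hBT hκB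
    obtain ⟨n, hn1, hn2, hnS⟩ := exists_sub_mem_window hD hS hcard hB hBT
    have hn2' : (n : ℝ) ≤ B := by exact_mod_cast hn2
    have h1 : distInt (n * κ) ≤ q * (2 * η) := by
      have : (n : ℝ) * κ = q * (n * θ) + ((-(n * round ((q : ℝ) * θ)) : ℤ) : ℝ) := by
        rw [hκdef]; push_cast; ring
      rw [this, distInt_add_int]
      refine (distInt_nat_mul_le _ _).trans ?_
      gcongr
      exact hdiff n hnS
    have h2 : |(n : ℝ) * κ| = n * |κ| := by rw [abs_mul, Nat.abs_cast]
    rw [distInt_eq_abs (by rw [h2]; nlinarith), h2] at h1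
    have h3 : (B : ℝ) / (16 * D) * |κ| ≤ 9 * D * (2 * η) :=
      (mul_le_mul_of_nonneg_right hn1 hκpos.le).trans
        (h1.trans (mul_le_mul_of_nonneg_right hq9 (by linarith)))
    rw [div_mul_eq_mul_div, div_le_iff₀ (by linarith)] at h3
    nlinarith
  by_cases hcase : |κ| * T ≤ 1 / 2
  · rw [le_div_iff₀ hT0]
    exact hkey T (by linarith) le_rfl hcase
  -- With B just below 1/(2|κ|), |κ|B would be nearly 1/2, while `hkey` bounds it by 288/2000.
  · exfalso
    push Not at hcase
    have hx : 1 / (2 * |κ|) < T := by rw [div_lt_iff₀ (by positivity)]; linarith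
    have hx0 : 0 ≤ 1 / (2 * |κ|) := by positivity
    have hx1 : 500 * D ≤ 1 / (2 * |κ|) := by rw [le_div_iff₀ (by positivity)]; linarith
    have hfl := Nat.lt_floor_add_one (1 / (2 * |κ|))
    have hfl' := Nat.floor_le hx0
    have hmul : |κ| * (1 / (2 * |κ|)) = 1 / 2 := by field_simp
    have := hkey ⌊1 / (2 * |κ|)⌋₊ (by linarith) (by exact_mod_cast hfl'.trans hx.le) (by
      nlinarith)
    nlinarith

/-! ### Weyl differencing in one variable. -/

/-- `HasLead e γ f` says that `f` behaves under taking differences like a polynomial of degree at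
most `e` whose coefficient of degree `e` is `γ`. -/
def HasLead : ℕ → ℝ → (ℤ → ℝ) → Prop
  | 0, γ, f => ∀ t, f t = γ
  | e + 1, γ, f => ∀ h : ℤ, HasLead e ((e + 1) * γ * h) fun t => f (t + h) - f t

/-- Shifting by h and subtracting cancels the coefficient of degree e + 1. The coefficient of degree
e is read off from the Hasse derivative of order e, which has degree at most 1. -/
theorem hasLead_eval (e : ℕ) (p : Polynomial ℝ) (hp : p.natDegree ≤ e) :
    HasLead e (p.coeff e) fun t : ℤ => p.eval (t : ℝ) := by
  induction e generalizing p with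
  | zero =>
    intro t
    rw [Polynomial.eq_C_of_natDegree_le_zero hp]
    simp
  | succ e ih =>
    intro h
    have hdd : (Polynomial.hasseDeriv e p).natDegree ≤ 1 :=
      (Polynomial.natDegree_hasseDeriv_le p e).trans (by omega)
    have hc0 : (Polynomial.taylor (h : ℝ) p - p).coeff e = (e + 1) * p.coeff (e + 1) * h := by
      rw [Polynomial.coeff_sub, Polynomial.taylor_coeff,
        Polynomial.eval_eq_sum_range' (Nat.lt_succ_of_le hdd)]
      simp [Finset.sum_range_succ, Polynomial.hasseDeriv_coeff, add_comm]
    have hdeg : (Polynomial.taylor (h : ℝ) p - p).natDegree ≤ e := by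
      rw [Polynomial.natDegree_le_iff_coeff_eq_zero]
      intro N hN
      rcases Nat.lt_or_ge (e + 1) N with h1 | h1
      · rw [Polynomial.coeff_sub, Polynomial.coeff_eq_zero_of_natDegree_lt,
          Polynomial.coeff_eq_zero_of_natDegree_lt, sub_zero]
        · omega
        · rw [Polynomial.natDegree_taylor]; omega
      · have : N = e + 1 := by omega
        subst this
        have hd0 : (Polynomial.hasseDeriv (e + 1) p).natDegree ≤ 0 :=
          (Polynomial.natDegree_hasseDeriv_le p (e + 1)).trans (by omega)
        rw [Polynomial.coeff_sub, Polynomial.taylor_coeff,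
          Polynomial.eval_eq_sum_range' (Nat.lt_succ_of_le hd0)]
        simp [Polynomial.hasseDeriv_coeff]
    have := ih _ hdeg
    rw [hc0] at this
    convert this using 2 with t
    rw [Polynomial.eval_sub, Polynomial.taylor_eval]
    push_cast
    rfl

/-- A dense set of integers has many differences that occur often. -/
theorem exists_many_differences {S : Finset ℤ} {T : ℕ} {D : ℝ} (hT : 0 < T) (hD : 1 ≤ D)
    (hS : ∀ s ∈ S, 0 ≤ s ∧ s < T) (hcard : (T : ℝ) ≤ D * S.card) :
    ∃ H ⊆ Finset.Ioo (-(T : ℤ)) T, (T : ℝ) ≤ 2 * D ^ 2 * H.card ∧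
      ∀ h ∈ H, (T : ℝ) ≤ 4 * D ^ 2 * (S.filter fun t => t + h ∈ S).card := by
  have hT0 : (0 : ℝ) < T := by exact_mod_cast hT
  set Sh : ℤ → Finset ℤ := fun h => S.filter fun t => t + h ∈ S with hSh
  set I := Finset.Ioo (-(T : ℤ)) T with hI
  set H := I.filter fun h => (T : ℝ) ≤ 4 * D ^ 2 * (Sh h).card with hH
  have hcardI : (I.card : ℝ) ≤ 2 * T := by
    rw [hI, Int.card_Ioo]
    have : ((T : ℤ) - -T - 1).toNat ≤ 2 * T := by omega
    exact_mod_cast this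
  have hcardS : (S.card : ℝ) ≤ T := by
    have h1 : S ⊆ Finset.Ico 0 (T : ℤ) := fun s hs => Finset.mem_Ico.2 (hS s hs)
    have := Finset.card_le_card h1
    simp at this
    exact_mod_cast this
  have hpairs : (S.card : ℝ) * S.card ≤ ∑ h ∈ I, ((Sh h).card : ℝ) := by
    have hmaps : ∀ p ∈ S ×ˢ S, p.2 - p.1 ∈ I := by
      intro p hp
      rw [Finset.mem_product] at hp
      have h1 := hS _ hp.1
      have h2 := hS _ hp.2
      rw [hI, Finset.mem_Ioo]
      omega
    have h1 := Finset.card_eq_sum_card_fiberwise hmaps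
    rw [Finset.card_product] at h1
    have h2 : ∀ h ∈ I, ((S ×ˢ S).filter fun p => p.2 - p.1 = h).card ≤ (Sh h).card := by
      intro h _
      refine Finset.card_le_card_of_injOn (fun p => p.1) ?_ ?_
      · intro p hp
        simp only [Finset.coe_filter, Finset.mem_product, Set.mem_ofPred_eq] at hp
        simp only [hSh, Finset.coe_filter, Set.mem_ofPred_eq]
        refine ⟨hp.1.1, ?_⟩
        rw [← hp.2, add_sub_cancel]
        exact hp.1.2
      · intro p hp p' hp' hpp
        simp only [Finset.coe_filter, Finset.mem_product, Set.mem_ofPred_eq] at hp hp'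
        refine Prod.ext hpp ?_
        have := hp.2
        have := hp'.2
        simp only at hpp
        omega
    have h3 : S.card * S.card ≤ ∑ h ∈ I, (Sh h).card := h1.le.trans (Finset.sum_le_sum h2)
    exact_mod_cast h3
  -- The differences outside H account for at most 2T · T/(4D²) pairs, half of the lower bound T²/D²
  -- for |S|². Each difference in H accounts for at most T pairs.
  have hHcard : (T : ℝ) ≤ 2 * D ^ 2 * H.card := by
    have h1 : ∀ h ∈ I, ((Sh h).card : ℝ) ≤
        (if (T : ℝ) ≤ 4 * D ^ 2 * (Sh h).card then (T : ℝ) else 0) + T / (4 * D ^ 2) := by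
      intro h _
      split_ifs with hh
      · have h2 : ((Sh h).card : ℝ) ≤ S.card := by
          exact_mod_cast Finset.card_filter_le _ _
        have : 0 ≤ (T : ℝ) / (4 * D ^ 2) := by positivity
        linarith
      · rw [zero_add, le_div_iff₀ (by positivity)]
        push Not at hh
        linarith
    have h2 := hpairs.trans (Finset.sum_le_sum h1)
    rw [Finset.sum_add_distrib, ← Finset.sum_filter, Finset.sum_const, Finset.sum_const,
      nsmul_eq_mul, nsmul_eq_mul] at h2
    have h3 : (I.card : ℝ) * (T / (4 * D ^ 2)) ≤ 2 * T * (T / (4 * D ^ 2)) := by gcongr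
    have h4 : (T : ℝ) * T ≤ D ^ 2 * (S.card * S.card) := by nlinarith
    have h5 : D ^ 2 * (2 * T * (T / (4 * D ^ 2))) = (T : ℝ) * T / 2 := by field_simp; ring
    have h6 : (T : ℝ) * T ≤ D ^ 2 * (H.card * T) + T * T / 2 := by nlinarith
    nlinarith
  exact ⟨H, Finset.filter_subset _ _, hHcard, fun h hh => (Finset.mem_filter.1 hh).2⟩

/-- A function with leading coefficient `γ` in degree `e` that is close to integers on a dense
subset of an interval of length `T` has a bounded multiple of `γ` within `O(T ^ (-e))` of an
integer. -/
theorem exists_distInt_mul_lead_le (e : ℕ) : ∃ c n : ℕ, 1 ≤ c ∧ ∀ (γ : ℝ) (f : ℤ → ℝ),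
    HasLead e γ f → ∀ (T : ℕ) (D η : ℝ) (S : Finset ℤ), 0 < T → 1 ≤ D →
    (∀ s ∈ S, 0 ≤ s ∧ s < T) → (T : ℝ) ≤ D * S.card → (∀ s ∈ S, distInt (f s) ≤ η) →
    c * D ^ n * η ≤ 1 → c * D ^ n ≤ T →
    ∃ q : ℕ, 1 ≤ q ∧ (q : ℝ) ≤ c * D ^ n ∧ distInt (q * γ) ≤ c * D ^ n * η / (T : ℝ) ^ e := by
  induction e with
  | zero =>
    refine ⟨1, 0, le_rfl, fun γ f hf T D η S hT hD hS hcard hη _ _ => ⟨1, le_rfl, by simp, ?_⟩⟩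
    obtain ⟨s, hs⟩ := nonempty_of_le_mul_card hT hcard
    have := hη s hs
    rw [hf s] at this
    simpa using this
  | succ e ih =>
    obtain ⟨c, n, hc, ih⟩ := ih
    -- With K = c(4D²)^n, the bound in degree e at density 1/(4D²), the strictest requirement is
    -- 2000(2D²K)² · 2Kη ≤ 1, that is 16000 D⁴K³η ≤ 1. The factor e + 1 leaves room for the same
    -- factor in the final multiplier.
    refine ⟨16000 * (e + 1) * c ^ 3 * 64 ^ n, 6 * n + 4, ?_, ?_⟩
    · have : 0 < 16000 * (e + 1) * c ^ 3 * 64 ^ n := by positivity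
      omega
    intro γ f hf T D η S hT hD hS hcard hη hsmall hlarge
    set K : ℝ := c * (4 * D ^ 2) ^ n with hK
    have hKK : ((16000 * (e + 1) * c ^ 3 * 64 ^ n : ℕ) : ℝ) * D ^ (6 * n + 4)
        = 16000 * (e + 1) * D ^ 4 * K ^ 3 := by
      have h64 : (64 : ℝ) ^ n = (4 ^ n) ^ 3 := by
        rw [← pow_mul, mul_comm, pow_mul]; norm_num
      rw [hK]; push_cast
      rw [h64, mul_pow 4]
      ring
    rw [hKK] at hsmall hlarge ⊢
    have hc' : (1 : ℝ) ≤ c := by exact_mod_cast hc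
    have hD2 : 1 ≤ D ^ 2 := one_le_pow₀ hD
    have hD4 : 1 ≤ D ^ 4 := one_le_pow₀ hD
    have hD24 : D ^ 2 ≤ D ^ 4 := pow_le_pow_right₀ hD (by norm_num)
    have hK1 : 1 ≤ K := one_le_mul_of_one_le_of_one_le hc' (one_le_pow₀ (by linarith))
    have hK3 : K ≤ K ^ 3 := le_self_pow₀ hK1 (by norm_num)
    have hK23 : K ^ 2 ≤ K ^ 3 := pow_le_pow_right₀ hK1 (by norm_num)
    have hK30 : 1 ≤ K ^ 3 := one_le_pow₀ hK1
    have he : (1 : ℝ) ≤ e + 1 := by linarith [(Nat.cast_nonneg e : (0 : ℝ) ≤ e)]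
    have hT0 : (0 : ℝ) < T := by exact_mod_cast hT
    have hT1 : (1 : ℝ) ≤ T := by exact_mod_cast hT
    have hη0 : 0 ≤ η := by
      obtain ⟨s, hs⟩ := nonempty_of_le_mul_card hT hcard
      exact (distInt_nonneg _).trans (hη s hs)
    have hbig : ∀ x : ℝ, x ≤ D ^ 4 * K ^ 3 → ∀ a : ℝ, 0 ≤ a → a ≤ 16000 →
        a * x ≤ 16000 * (e + 1) * D ^ 4 * K ^ 3 := by
      intro x hx a ha ha'
      have h0 : 0 ≤ D ^ 4 * K ^ 3 := by positivity
      calc a * x ≤ a * (D ^ 4 * K ^ 3) := by gcongr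
        _ ≤ (16000 * (e + 1)) * (D ^ 4 * K ^ 3) := by gcongr; nlinarith
        _ = _ := by ring
    have hKbig : K ≤ D ^ 4 * K ^ 3 := by nlinarith
    obtain ⟨H, hHI, hHcard, hHS⟩ := exists_many_differences hT hD hS hcard
    have hex : ∀ h ∈ H, ∃ q : ℕ, q ∈ Finset.Icc 1 ⌊K⌋₊ ∧
        distInt (q * ((e + 1) * γ * h)) ≤ K * (2 * η) / (T : ℝ) ^ e := by
      intro h hh
      obtain ⟨q, hq1, hq2, hq3⟩ := ih _ _ (hf h) T (4 * D ^ 2) (2 * η) _ hT (by linarith)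
        (fun s hs => hS s (Finset.mem_of_mem_filter s hs)) (hHS h hh) (fun s hs => by
          rw [Finset.mem_filter] at hs
          linarith [distInt_sub_le (f (s + h)) (f s), hη _ hs.1, hη _ hs.2])
        (by
          rw [← hK]
          have := hbig K hKbig 2 (by norm_num) (by norm_num)
          nlinarith)
        (by
          rw [← hK]
          have := hbig K hKbig 1 (by norm_num) (by norm_num)
          linarith)
      exact ⟨q, Finset.mem_Icc.2 ⟨hq1, Nat.le_floor hq2⟩, hq3⟩
    choose! qf hqf using hex
    -- Pigeonhole makes the multiplier independent of h at the cost of a factor K in density. Then h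
    -- ↦ q(e + 1)γh is a linear phase near the integers on a dense set of h, and the linear case
    -- finishes.
    obtain ⟨q, hq, hqcard⟩ := Finset.exists_le_card_fiber_of_nsmul_le_card_of_maps_to
      (s := H) (t := Finset.Icc 1 ⌊K⌋₊) (f := qf) (b := (H.card : ℝ) / K)
      (fun h hh => (hqf h hh).1) (Finset.nonempty_Icc.2 (Nat.le_floor (by simpa using hK1))) (by
        rw [Nat.card_Icc, nsmul_eq_mul, add_tsub_cancel_right, mul_div_assoc', div_le_iff₀
          (by linarith), mul_comm]
        gcongr
        exact Nat.floor_le (by linarith))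
    rw [Finset.mem_Icc] at hq
    have hqK : (q : ℝ) ≤ K := (Nat.le_floor_iff (by linarith)).1 hq.2
    rw [div_le_iff₀ (by linarith)] at hqcard
    have hTe : 1 ≤ (T : ℝ) ^ e := one_le_pow₀ hT1
    have hDK : 1 ≤ 2 * D ^ 2 * K := by nlinarith
    have hdense : (T : ℝ) ≤ 2 * D ^ 2 * K * (H.filter fun h => qf h = q).card := by
      refine hHcard.trans ?_
      rw [mul_assoc (2 * D ^ 2), mul_comm K]
      gcongr
    have hclose : ∀ h ∈ H.filter fun h => qf h = q,
        distInt (q * ((e + 1) * γ) * h) ≤ K * (2 * η) / (T : ℝ) ^ e := by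
      intro h hh
      rw [Finset.mem_filter] at hh
      have := (hqf h hh.1).2
      rw [hh.2, ← mul_assoc] at this
      exact this
    have hsmall' : 2000 * (2 * D ^ 2 * K) ^ 2 * (K * (2 * η) / (T : ℝ) ^ e) ≤ 1 := by
      have h1 : K * (2 * η) / (T : ℝ) ^ e ≤ K * (2 * η) := div_le_self (by positivity) hTe
      have h2 := hbig _ le_rfl 16000 (by norm_num) le_rfl
      calc 2000 * (2 * D ^ 2 * K) ^ 2 * (K * (2 * η) / (T : ℝ) ^ e)
          ≤ 2000 * (2 * D ^ 2 * K) ^ 2 * (K * (2 * η)) := by gcongr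
        _ = (16000 * (D ^ 4 * K ^ 3)) * η := by ring
        _ ≤ 16000 * (e + 1) * D ^ 4 * K ^ 3 * η := by gcongr
        _ ≤ 1 := hsmall
    have hlarge' : 9 * (2 * D ^ 2 * K) ≤ T := by
      have h1 : D ^ 2 * K ≤ D ^ 4 * K ^ 3 := by gcongr
      have := hbig _ h1 18 (by norm_num) (by norm_num)
      linarith
    obtain ⟨q', hq'1, hq'2, hq'3⟩ := exists_distInt_mul_le hDK
      (fun h hh => Finset.mem_Ioo.1 (hHI (Finset.mem_of_mem_filter h hh)))
      hdense hclose hsmall' hlarge'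
    refine ⟨q' * q * (e + 1), ?_, ?_, ?_⟩
    · have : 0 < q' * q * (e + 1) := Nat.mul_pos (Nat.mul_pos hq'1 hq.1) (by omega)
      omega
    · push_cast
      calc (q' : ℝ) * q * (e + 1) ≤ (9 * (2 * D ^ 2 * K)) * K * (e + 1) := by gcongr
        _ = 18 * (e + 1) * D ^ 2 * K ^ 2 := by ring
        _ ≤ 16000 * (e + 1) * D ^ 4 * K ^ 3 := by gcongr; norm_num
    · have h1 : ((q' * q * (e + 1) : ℕ) : ℝ) * γ = q' * (q * ((e + 1) * γ)) := by push_cast; ring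
      rw [h1]
      refine hq'3.trans ?_
      have h2 : 288 * (2 * D ^ 2 * K) ^ 2 * (K * (2 * η) / (T : ℝ) ^ e) / T
          = 2304 * (D ^ 4 * K ^ 3) * η / (T : ℝ) ^ (e + 1) := by
        rw [pow_succ]; field_simp; ring
      rw [h2]
      gcongr ?_ * η / _
      exact hbig _ le_rfl 2304 (by norm_num) (by norm_num)

/-! ### Polynomials in several variables and their restrictions to lines. -/

theorem distInt_neg (x : ℝ) : distInt (-x) = distInt x := by
  have h : ∀ y, distInt (-y) ≤ distInt y := fun y => by
    simpa using distInt_int_mul_le (-1) y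
  exact le_antisymm (h x) (by simpa using h (-x))

theorem interval_one (M : ℝ) : interval 1 M = Finset.Icc 1 ⌊M⌋ := by simp [interval]

theorem card_interval_one (M : ℝ) : (interval 1 M).card = ⌊M⌋₊ := by
  rw [interval_one, Int.card_Icc, add_sub_cancel_right, Int.floor_toNat]

theorem card_support_le {r e : ℕ} {P : MvPolynomial (Fin r) ℤ} (hP : P.totalDegree ≤ e) :
    P.support.card ≤ (e + 1) ^ r := by
  have h : (Fintype.piFinset fun _ : Fin r => Finset.range (e + 1)).card = (e + 1) ^ r := by
    simp
  rw [← h]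
  refine Finset.card_le_card_of_injOn (fun m => (m : Fin r → ℕ)) ?_ (fun a _ b _ h =>
    DFunLike.coe_injective h)
  intro m hm
  rw [Finset.mem_coe, Fintype.mem_piFinset]
  intro i
  rw [Finset.mem_range, Nat.lt_succ_iff]
  exact ((MvPolynomial.monomial_le_degreeOf i hm).trans
    (MvPolynomial.degreeOf_le_totalDegree P i)).trans hP

theorem sum_le_of_mem_support {r e : ℕ} {P : MvPolynomial (Fin r) ℤ} (hP : P.totalDegree ≤ e)
    {m : Fin r →₀ ℕ} (hm : m ∈ P.support) : ∑ i, m i ≤ e := by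
  refine le_trans (le_of_eq ?_) ((MvPolynomial.le_totalDegree hm).trans hP)
  rw [Finsupp.sum_fintype _ _ fun _ => rfl]

theorem abs_eval_le {r e : ℕ} {P : MvPolynomial (Fin r) ℤ} {A M : ℝ}
    (hP : P.totalDegree ≤ e) (hA : ∀ m, |((P.coeff m : ℤ) : ℝ)| ≤ A) (hM : 1 ≤ M)
    {x : Fin r → ℤ} (hx : ∀ i, |(x i : ℝ)| ≤ M) :
    |((MvPolynomial.eval x P : ℤ) : ℝ)| ≤ (e + 1) ^ r * A * M ^ e := by
  have hA0 : 0 ≤ A := (abs_nonneg _).trans (hA 0)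
  rw [MvPolynomial.eval_eq']
  push_cast
  refine (Finset.abs_sum_le_sum_abs _ _).trans ?_
  have h1 : ∀ m ∈ P.support, |((P.coeff m : ℤ) : ℝ) * ∏ i, (x i : ℝ) ^ m i| ≤ A * M ^ e := by
    intro m hm
    rw [abs_mul, Finset.abs_prod]
    refine mul_le_mul (hA m) ?_ (Finset.prod_nonneg fun _ _ => abs_nonneg _) hA0
    calc ∏ i, |(x i : ℝ) ^ m i| ≤ ∏ i, M ^ m i := by
          refine Finset.prod_le_prod (fun _ _ => abs_nonneg _) fun i _ => ?_
          rw [abs_pow]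
          exact pow_le_pow_left₀ (abs_nonneg _) (hx i) _
      _ = M ^ ∑ i, m i := Finset.prod_pow_eq_pow_sum _ _ _
      _ ≤ M ^ e := pow_le_pow_right₀ hM (sum_le_of_mem_support hP hm)
  refine (Finset.sum_le_card_nsmul _ _ _ h1).trans ?_
  rw [nsmul_eq_mul, ← mul_assoc]
  gcongr
  exact_mod_cast card_support_le hP

/-- A direction in which the top degree part of a polynomial does not vanish. -/
theorem exists_direction {r : ℕ} {P : MvPolynomial (Fin r) ℤ} (hP : P ≠ 0) :
    ∃ v : Fin r → ℤ, (∀ i, 0 ≤ v i ∧ v i ≤ P.totalDegree) ∧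
      MvPolynomial.eval v (MvPolynomial.homogeneousComponent P.totalDegree P) ≠ 0 := by
  set e := P.totalDegree with he
  set H := MvPolynomial.homogeneousComponent e P with hH
  have hH0 : H ≠ 0 := by
    obtain ⟨m, hm, hmd⟩ := Finset.exists_mem_eq_sup P.support
      (MvPolynomial.support_nonempty.2 hP) (fun s => s.sum fun _ n => n)
    intro h0
    have h1 : MvPolynomial.coeff m H = MvPolynomial.coeff m P := by
      rw [hH, MvPolynomial.coeff_homogeneousComponent, if_pos]
      rw [he, MvPolynomial.totalDegree, hmd]
      rfl
    rw [h0, MvPolynomial.coeff_zero] at h1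
    exact MvPolynomial.mem_support_iff.1 hm h1.symm
  by_contra! hcon
  -- A non-zero polynomial of degree at most e in each variable cannot vanish on a grid of side e +
  -- 1.
  refine hH0 (MvPolynomial.eq_zero_of_eval_zero_at_prod_finset H
    (fun _ => Finset.Icc 0 (e : ℤ)) (fun i => ?_) fun x hx => ?_)
  · have h1 := MvPolynomial.degreeOf_le_totalDegree H i
    have h2 : H.totalDegree ≤ e :=
      (MvPolynomial.homogeneousComponent_isHomogeneous e P).totalDegree_le
    simp only [Int.card_Icc]
    omega
  · exact hcon x fun i => Finset.mem_Icc.1 (hx i)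

theorem coeff_prod_linear_pow {ι : Type*} (s : Finset ι) (x v : ι → ℤ) (m : ι → ℕ) :
    (∏ i ∈ s, (Polynomial.C (x i) + Polynomial.C (v i) * Polynomial.X) ^ m i).natDegree
        ≤ ∑ i ∈ s, m i ∧
      (∏ i ∈ s, (Polynomial.C (x i) + Polynomial.C (v i) * Polynomial.X) ^ m i).coeff
        (∑ i ∈ s, m i) = ∏ i ∈ s, v i ^ m i := by
  classical
  have hlin : ∀ i, (Polynomial.C (x i) + Polynomial.C (v i) * Polynomial.X).natDegree ≤ 1 :=
    fun i => by rw [add_comm]; exact Polynomial.natDegree_linear_le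
  have hpow : ∀ i, ((Polynomial.C (x i) + Polynomial.C (v i) * Polynomial.X) ^ m i).natDegree
      ≤ m i := fun i => by
    simpa using Polynomial.natDegree_pow_le_of_le (m i) (hlin i)
  induction s using Finset.induction_on with
  | empty => simp
  | insert i s hi ih =>
    rw [Finset.prod_insert hi, Finset.sum_insert hi, Finset.prod_insert hi]
    refine ⟨Polynomial.natDegree_mul_le_of_le (hpow i) ih.1, ?_⟩
    rw [Polynomial.coeff_mul_add_eq_of_natDegree_le (hpow i) ih.1, ih.2]
    congr 1
    have := Polynomial.coeff_pow_of_natDegree_le (m := m i) (hlin i)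
    rw [mul_one] at this
    rw [this, Polynomial.coeff_add, Polynomial.coeff_C_of_ne_zero one_ne_zero, zero_add,
      Polynomial.coeff_C_mul_X, if_pos rfl]

/-- The restriction of a polynomial of degree at most `e` to a line, whose leading coefficient is
the value of the component of degree `e` at the direction of the line. -/
theorem exists_line_restriction {r e : ℕ} {P : MvPolynomial (Fin r) ℤ} (hP : P.totalDegree ≤ e)
    (x v : Fin r → ℤ) : ∃ p : Polynomial ℤ, p.natDegree ≤ e ∧
      p.coeff e = MvPolynomial.eval v (MvPolynomial.homogeneousComponent e P) ∧
      ∀ t : ℤ, p.eval t = MvPolynomial.eval (fun i => x i + t * v i) P := by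
  refine ⟨MvPolynomial.eval₂ Polynomial.C
    (fun i => Polynomial.C (x i) + Polynomial.C (v i) * Polynomial.X) P, ?_, ?_, fun t => ?_⟩
  · rw [MvPolynomial.eval₂_eq']
    refine Polynomial.natDegree_sum_le_of_forall_le _ _ fun m hm => ?_
    exact (Polynomial.natDegree_C_mul_le _ _).trans
      ((coeff_prod_linear_pow _ x v m).1.trans (sum_le_of_mem_support hP hm))
  · rw [MvPolynomial.eval₂_eq', Polynomial.finsetSum_coeff,
      MvPolynomial.homogeneousComponent_apply, map_sum, Finset.sum_filter]
    refine Finset.sum_congr rfl fun m hm => ?_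
    have hdeg : m.degree = ∑ i, m i := by
      rw [Finsupp.degree_eq_sum]
    rw [Polynomial.coeff_C_mul]
    split_ifs with h
    · rw [MvPolynomial.eval_monomial, ← h, hdeg, (coeff_prod_linear_pow _ x v m).2,
        Finsupp.prod_fintype _ _ fun _ => pow_zero _]
    · rw [Polynomial.coeff_eq_zero_of_natDegree_lt, mul_zero]
      have h1 := (coeff_prod_linear_pow Finset.univ x v m).1
      have h2 := sum_le_of_mem_support hP hm
      omega
  · rw [MvPolynomial.eval₂_eq', MvPolynomial.eval_eq', Polynomial.eval_finsetSum]
    refine Finset.sum_congr rfl fun m _ => ?_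
    rw [Polynomial.eval_mul, Polynomial.eval_prod, Polynomial.eval_C]
    congr 1
    refine Finset.prod_congr rfl fun i _ => ?_
    simp [mul_comm]

/-- A dense subset of a box has a dense intersection with some line in a given direction. -/
theorem exists_dense_line {r N T e : ℕ} {D : ℝ} (hN : 1 ≤ N) (hTN : e * T ≤ N)
    {S : Finset (Fin r → ℤ)} (hS : S ⊆ Fintype.piFinset fun _ => Finset.Icc 1 (N : ℤ))
    (hcard : (N : ℝ) ^ r ≤ D * S.card) {v : Fin r → ℤ} (hv : ∀ i, 0 ≤ v i ∧ v i ≤ e) :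
    ∃ x : Fin r → ℤ, (T : ℝ) ≤ 2 ^ r * D *
      ((Finset.Ico 0 (T : ℤ)).filter fun t => (fun i => x i + t * v i) ∈ S).card := by
  -- U contains every s - tv with s in the box and 0 ≤ t < T, and it is at most 2^r times as large
  -- as the box because eT ≤ N. Averaging over base points x in U yields the line.
  set U : Finset (Fin r → ℤ) := Fintype.piFinset fun _ => Finset.Icc (1 - (e * T : ℤ)) (N : ℤ)
    with hU
  have hUne : U.Nonempty := by
    refine ⟨fun _ => 1, ?_⟩
    rw [hU, Fintype.mem_piFinset]
    intro _
    rw [Finset.mem_Icc]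
    have : (0 : ℤ) ≤ e * T := by positivity
    omega
  have hUcard : (U.card : ℝ) ≤ 2 ^ r * N ^ r := by
    rw [hU, Fintype.card_piFinset_const, Int.card_Icc, ← mul_pow]
    have : ((N : ℤ) + 1 - (1 - e * T)).toNat ≤ 2 * N := by
      have : (e : ℤ) * T ≤ N := by exact_mod_cast hTN
      omega
    push_cast
    gcongr
    exact_mod_cast this
  have hshift : ∀ t ∈ Finset.Ico 0 (T : ℤ),
      S.card ≤ (U.filter fun x => (fun i => x i + t * v i) ∈ S).card := by
    intro t ht
    rw [Finset.mem_Ico] at ht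
    refine Finset.card_le_card_of_injOn (fun s i => s i - t * v i) (fun s hs => ?_) ?_
    · have hs' := Fintype.mem_piFinset.1 (hS hs)
      simp only [Finset.coe_filter, Set.mem_ofPred_eq, sub_add_cancel]
      refine ⟨Fintype.mem_piFinset.2 fun i => ?_, hs⟩
      have h1 := Finset.mem_Icc.1 (hs' i)
      have h2 := hv i
      have h3 : 0 ≤ t * v i := mul_nonneg ht.1 h2.1
      have h4 : t * v i ≤ T * e := mul_le_mul ht.2.le h2.2 h2.1 (by omega)
      rw [Finset.mem_Icc]
      constructor <;> linarith
    · intro s _ s' _ h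
      funext i
      have := congrFun h i
      simpa using this
  have hsum : T * S.card ≤ ∑ x ∈ U,
      ((Finset.Ico 0 (T : ℤ)).filter fun t => (fun i => x i + t * v i) ∈ S).card := by
    have h1 := Finset.sum_le_sum hshift
    rw [Finset.sum_const, Int.card_Ico, sub_zero, Int.toNat_natCast, smul_eq_mul] at h1
    refine h1.trans (le_of_eq ?_)
    simp_rw [Finset.card_filter]
    exact Finset.sum_comm
  obtain ⟨x, _, hx⟩ := Finset.exists_le_of_sum_le hUne (f := fun _ => (T * S.card : ℝ) / U.card)
    (g := fun x => (((Finset.Ico 0 (T : ℤ)).filter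
      fun t => (fun i => x i + t * v i) ∈ S).card : ℝ)) (by
      have hU0 : (U.card : ℝ) ≠ 0 := by exact_mod_cast hUne.card_pos.ne'
      rw [Finset.sum_const, nsmul_eq_mul, mul_div_cancel₀ _ hU0]
      exact_mod_cast hsum)
  refine ⟨x, ?_⟩
  have hU0 : (0 : ℝ) < U.card := by exact_mod_cast hUne.card_pos
  rw [div_le_iff₀ hU0] at hx
  have hN0 : (0 : ℝ) < N ^ r := by
    have : (0 : ℝ) < N := by exact_mod_cast hN
    positivity
  set a : ℝ := (((Finset.Ico 0 (T : ℤ)).filter fun t => (fun i => x i + t * v i) ∈ S).card : ℝ)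
  have hS0 : 0 < D * S.card := lt_of_lt_of_le hN0 hcard
  have hD : 0 < D := pos_of_mul_pos_left hS0 (by positivity)
  have ha : 0 ≤ a := by positivity
  have h1 : (T : ℝ) * (D * S.card) ≤ 2 ^ r * D * a * (D * S.card) :=
    calc (T : ℝ) * (D * S.card) = D * (T * S.card) := by ring
      _ ≤ D * (a * (2 ^ r * N ^ r)) := mul_le_mul_of_nonneg_left (hx.trans (by gcongr)) hD.le
      _ ≤ D * (a * (2 ^ r * (D * S.card))) := by gcongr
      _ = _ := by ring
  exact le_of_mul_le_mul_right h1 hS0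

/-- If a non-zero multiple of an integer polynomial is close to integers on a dense subset of a
box, then that multiple is close to a rational with bounded denominator. -/
theorem exists_distInt_mul_le_of_dense (e r : ℕ) : ∃ c n : ℕ, 1 ≤ c ∧
    ∀ (A : ℝ) (P : MvPolynomial (Fin r) ℤ), P ≠ 0 → P.totalDegree = e →
    (∀ m, |((P.coeff m : ℤ) : ℝ)| ≤ A) → ∀ (M D η α : ℝ) (S : Finset (Fin r → ℤ)), 1 ≤ D →
    S ⊆ (Fintype.piFinset fun _ => interval 1 M) →
    ((Fintype.piFinset fun _ : Fin r => interval 1 M).card : ℝ) ≤ D * S.card →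
    (∀ h ∈ S, distInt (α * (MvPolynomial.eval h P : ℤ)) ≤ η) →
    c * D ^ n * η ≤ 1 → c * D ^ n ≤ M →
    ∃ q : ℕ, 1 ≤ q ∧ (q : ℝ) ≤ c * D ^ n * A ∧ distInt (q * α) ≤ c * D ^ n * η / M ^ e := by
  obtain ⟨c, n, hc, hlead⟩ := exists_distInt_mul_lead_le e
  -- With E = e + 1: density drops by 2^r on passing to a line, the powers of 4E convert T back to M
  -- through M ≤ 4ET, and E^(r+e) A bounds the top-degree part at v.
  refine ⟨c * (2 ^ r) ^ n * (4 * (e + 1)) ^ (e + 1) * (e + 1) ^ (r + e), n, ?_, ?_⟩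
  · have : 0 < c * (2 ^ r) ^ n * (4 * (e + 1)) ^ (e + 1) * (e + 1) ^ (r + e) := by positivity
    omega
  intro A P hP0 hPe hA M D η α S hD hS hcard hη hsmall hlarge
  set K : ℝ := c * (2 ^ r * D) ^ n with hK
  set E : ℝ := (e : ℝ) + 1 with hE
  have hE1 : 1 ≤ E := by rw [hE]; linarith [(Nat.cast_nonneg e : (0 : ℝ) ≤ e)]
  have hKK : ((c * (2 ^ r) ^ n * (4 * (e + 1)) ^ (e + 1) * (e + 1) ^ (r + e) : ℕ) : ℝ) * D ^ n
      = K * (4 * E) ^ (e + 1) * E ^ (r + e) := by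
    push_cast; rw [hK, hE, mul_pow (2 ^ r)]; ring
  rw [hKK] at hsmall hlarge ⊢
  have hc' : (1 : ℝ) ≤ c := by exact_mod_cast hc
  have h2r : (1 : ℝ) ≤ 2 ^ r := one_le_pow₀ (by norm_num)
  have h2D : 1 ≤ 2 ^ r * D := one_le_mul_of_one_le_of_one_le h2r hD
  have hK1 : 1 ≤ K := one_le_mul_of_one_le_of_one_le hc' (one_le_pow₀ h2D)
  have hEr : 1 ≤ E ^ (r + e) := one_le_pow₀ hE1
  have h4E : 4 * E ≤ (4 * E) ^ (e + 1) := le_self_pow₀ (by linarith) (by omega)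
  have hKE : K * (4 * E) ≤ K * (4 * E) ^ (e + 1) * E ^ (r + e) := by
    calc K * (4 * E) = K * (4 * E) * 1 := by ring
      _ ≤ _ := by gcongr
  have hKE' : K ≤ K * (4 * E) ^ (e + 1) * E ^ (r + e) := by nlinarith
  have hM4 : 4 * E ≤ M := by nlinarith
  have hM0 : 0 < M := by linarith
  set N := ⌊M⌋₊ with hN
  have hNM : M < N + 1 := Nat.lt_floor_add_one M
  have hNM' : (N : ℝ) ≤ M := Nat.floor_le hM0.le
  have hNe : e + 1 ≤ N := Nat.le_floor (by push_cast; linarith)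
  set T := N / (e + 1) with hT
  have hTpos : 0 < T := Nat.div_pos hNe (by omega)
  have hTM : M ≤ 4 * E * T := by
    have h1 : N < (T + 1) * (e + 1) := by
      rw [hT, mul_comm]; exact Nat.lt_mul_div_succ N (by omega)
    have h2 : (N : ℝ) < (T + 1) * E := by rw [hE]; exact_mod_cast h1
    have h3 : (1 : ℝ) ≤ T := by exact_mod_cast hTpos
    nlinarith
  have hbox : (Fintype.piFinset fun _ : Fin r => interval 1 M)
      = Fintype.piFinset fun _ => Finset.Icc 1 (N : ℤ) := by
    rw [interval_one, hN, Int.natCast_floor_eq_floor hM0.le]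
  rw [hbox] at hS hcard
  rw [Fintype.card_piFinset_const, Int.card_Icc, add_sub_cancel_right, Int.toNat_natCast] at hcard
  push_cast at hcard
  have hS1 : S.Nonempty := by
    rw [Finset.nonempty_iff_ne_empty]
    rintro rfl
    have : (0 : ℝ) < (N : ℝ) ^ r := pow_pos (by exact_mod_cast (by omega : 0 < N)) r
    simp at hcard
    linarith
  have hη0 : 0 ≤ η := by
    obtain ⟨s, hs⟩ := hS1
    exact (distInt_nonneg _).trans (hη s hs)
  obtain ⟨v, hv, hv0⟩ := exists_direction hP0
  rw [hPe] at hv hv0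
  obtain ⟨x, hx⟩ := exists_dense_line (T := T) (e := e) (by omega)
    (le_trans (Nat.mul_le_mul_right _ (Nat.le_succ e)) (Nat.mul_div_le N (e + 1))) hS hcard hv
  obtain ⟨p, hp1, hp2, hp3⟩ := exists_line_restriction hPe.le x v
  set L := MvPolynomial.eval v (MvPolynomial.homogeneousComponent e P) with hL
  have hLA : |(L : ℝ)| ≤ E ^ (r + e) * A := by
    have h1 := abs_eval_le (A := A) (M := E) (x := v)
      (MvPolynomial.homogeneousComponent_isHomogeneous e P).totalDegree_le (fun m => by
        rw [MvPolynomial.coeff_homogeneousComponent]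
        split_ifs
        · exact hA m
        · simpa using (abs_nonneg _).trans (hA 0)) hE1 (fun i => by
        have h2 : (0 : ℝ) ≤ v i := by exact_mod_cast (hv i).1
        have h3 : (v i : ℝ) ≤ e := by exact_mod_cast (hv i).2
        rw [abs_of_nonneg h2]
        linarith)
    refine h1.trans (le_of_eq ?_)
    rw [pow_add]; ring
  have hHL : HasLead e (α * L) fun t => α * (MvPolynomial.eval (fun i => x i + t * v i) P : ℤ) := by
    have h1 := hasLead_eval e (Polynomial.C α * p.map (Int.castRingHom ℝ))
      ((Polynomial.natDegree_C_mul_le _ _).trans (Polynomial.natDegree_map_le.trans hp1))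
    rw [Polynomial.coeff_C_mul, Polynomial.coeff_map, hp2, eq_intCast] at h1
    convert h1 using 2 with t
    rw [Polynomial.eval_mul, Polynomial.eval_C, ← hp3, Polynomial.eval_intCast_map]
    rfl
  obtain ⟨q, hq1, hq2, hq3⟩ := hlead _ _ hHL T (2 ^ r * D) η _ hTpos h2D
    (fun t ht => Finset.mem_Ico.1 (Finset.mem_of_mem_filter t ht)) hx
    (fun t ht => hη _ (Finset.mem_filter.1 ht).2) (by
      rw [← hK]
      exact (mul_le_mul_of_nonneg_right hKE' hη0).trans hsmall) (by
      rw [← hK]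
      have h5 : K * (4 * E) ≤ 4 * E * T := (hKE.trans hlarge).trans hTM
      nlinarith)
  rw [← hK] at hq2 hq3
  have hLabs : ((L.natAbs : ℕ) : ℝ) = |(L : ℝ)| := by
    rw [Nat.cast_natAbs, Int.cast_abs]
  -- The leading coefficient along the line is αL with L a non-zero integer, so |L| joins the
  -- multiplier. This is where the factor A in its bound comes from.
  refine ⟨q * L.natAbs, Nat.mul_pos hq1 (Int.natAbs_pos.2 hv0), ?_, ?_⟩
  · push_cast
    rw [hLabs]
    have h1 : 1 ≤ (4 * E) ^ (e + 1) := one_le_pow₀ (by linarith)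
    have hA0 : 0 ≤ A := (abs_nonneg _).trans (hA 0)
    calc (q : ℝ) * |(L : ℝ)| ≤ K * (E ^ (r + e) * A) := by gcongr
      _ = K * 1 * E ^ (r + e) * A := by ring
      _ ≤ _ := by gcongr
  · have h1 : distInt (((q * L.natAbs : ℕ) : ℝ) * α) = distInt (q * (α * L)) := by
      push_cast
      rw [hLabs]
      rcases le_total 0 (L : ℝ) with h | h
      · rw [abs_of_nonneg h]; congr 1; ring
      · rw [abs_of_nonpos h, show (q : ℝ) * -(L : ℝ) * α = -(q * (α * L)) by ring, distInt_neg]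
    rw [h1]
    refine hq3.trans ?_
    rw [div_le_div_iff₀ (by positivity) (by positivity)]
    calc K * η * M ^ e ≤ K * η * (4 * E * T) ^ e := by gcongr
      _ = K * (4 * E) ^ e * 1 * η * T ^ e := by rw [mul_pow (4 * E)]; ring
      _ ≤ K * (4 * E) ^ (e + 1) * E ^ (r + e) * η * T ^ e := by
          gcongr
          · linarith
          · omega

/-! ### Characters, exponential sums and the Dirichlet kernel. -/

/-- The standard character `x ↦ exp (2 π i x)`. -/
noncomputable def ex (x : ℝ) : ℂ := Complex.exp (((2 * Real.pi * x : ℝ) : ℂ) * Complex.I)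

theorem ex_add (x y : ℝ) : ex (x + y) = ex x * ex y := by
  rw [ex, ex, ex, ← Complex.exp_add]
  congr 1
  push_cast
  ring

theorem ex_zero : ex 0 = 1 := by simp [ex]

theorem norm_ex (x : ℝ) : ‖ex x‖ = 1 := Complex.norm_exp_ofReal_mul_I _

theorem ex_intCast (n : ℤ) : ex n = 1 := by
  rw [ex, Complex.exp_eq_one_iff]
  exact ⟨n, by push_cast; ring⟩

theorem ex_nat_mul (n : ℕ) (x : ℝ) : ex (n * x) = ex x ^ n := by
  rw [ex, ex, ← Complex.exp_nat_mul]
  congr 1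
  push_cast
  ring

theorem conj_ex (x : ℝ) : (starRingEnd ℂ) (ex x) = ex (-x) := by
  rw [ex, ex, ← Complex.exp_conj, map_mul, Complex.conj_ofReal, Complex.conj_I]
  congr 1
  push_cast
  ring

theorem ex_sub_round (x : ℝ) : ex (x - round x) = ex x := by
  have := ex_add (x - round x) (round x)
  rwa [ex_intCast, mul_one, sub_add_cancel, eq_comm] at this

theorem norm_ex_sub_one (x : ℝ) : ‖ex x - 1‖ = 2 * |Real.sin (Real.pi * x)| := by
  rw [ex, mul_comm _ Complex.I, Complex.norm_exp_I_mul_ofReal_sub_one, Real.norm_eq_abs, abs_mul,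
    abs_two]
  congr 3
  ring

theorem norm_ex_sub_one_le (x : ℝ) : ‖ex x - 1‖ ≤ 2 * Real.pi * distInt x := by
  rw [← ex_sub_round, norm_ex_sub_one, distInt, mul_assoc]
  gcongr
  refine Real.abs_sin_le_abs.trans (le_of_eq ?_)
  rw [abs_mul, abs_of_pos Real.pi_pos]

theorem le_norm_ex_sub_one (x : ℝ) : 4 * distInt x ≤ ‖ex x - 1‖ := by
  rw [← ex_sub_round, norm_ex_sub_one, distInt]
  have h := abs_sub_round x
  have hpi := Real.pi_pos
  have h2 := Real.mul_abs_le_abs_sin (x := Real.pi * (x - round x)) (by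
    rw [abs_mul, abs_of_pos hpi]
    nlinarith)
  rw [abs_mul, abs_of_pos hpi] at h2
  have h3 : 2 / Real.pi * (Real.pi * |x - round x|) = 2 * |x - round x| := by field_simp
  linarith

/-- The normalised exponential sum over a multiset of integers. -/
noncomputable def charSum (S : Multiset ℤ) (θ : ℝ) : ℂ :=
  (S.map fun x : ℤ => ex (x * θ)).sum / Multiset.card S

theorem charSum_sumMultiset (S T : Multiset ℤ) (θ : ℝ) :
    charSum (sumMultiset S T) θ = charSum S θ * charSum T θ := by
  have h : (fun p : ℤ × ℤ => ex (((p.1 + p.2 : ℤ) : ℝ) * θ))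
      = fun p : ℤ × ℤ => ex (p.1 * θ) * ex (p.2 * θ) := by
    funext p
    rw [← ex_add]
    push_cast
    rw [add_mul]
  rw [charSum, charSum, charSum, sumMultiset, Multiset.map_map, Multiset.card_map,
    Multiset.card_product, div_mul_div_comm, Nat.cast_mul]
  congr 1
  rw [Function.comp_def, h]
  induction S using Multiset.induction_on with
  | empty => simp
  | cons a S ih =>
    rw [Multiset.cons_product, Multiset.map_add, Multiset.sum_add, ih, Multiset.map_map,
      Multiset.map_cons, Multiset.sum_cons, add_mul, ← Multiset.sum_map_mul_left (s := T) (a := ex (a * θ))]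
    rfl

theorem charSum_dilate (q : ℤ) (S : Multiset ℤ) (θ : ℝ) :
    charSum (dilate q S) θ = charSum S (q * θ) := by
  rw [charSum, charSum, dilate, Multiset.map_map, Multiset.card_map, Function.comp_def]
  congr 3
  funext x
  congr 1
  push_cast
  ring

theorem charSum_finset (S : Finset ℤ) (θ : ℝ) :
    charSum S.val θ = (∑ x ∈ S, ex (x * θ)) / S.card := rfl

/-- The coefficients in a progression range independently, so the exponential sum factors. -/
theorem charSum_progression {k : ℕ} (a : Fin k → ℤ) (M θ : ℝ) :
    charSum (progression a M) θ = ∏ j, charSum (interval (-M) M).val (a j * θ) := by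
  simp_rw [charSum_finset, Finset.prod_div_distrib, Finset.prod_univ_sum]
  rw [charSum, progression, Multiset.map_map, Multiset.card_map, Finset.card_val,
    Fintype.card_piFinset_const, Finset.prod_const, Finset.card_univ, Fintype.card_fin,
    Nat.cast_pow]
  congr 1
  refine Finset.sum_congr rfl fun m _ => ?_
  have h : ∀ s : Finset (Fin k), ex (∑ j ∈ s, m j * (a j * θ)) = ∏ j ∈ s, ex (m j * (a j * θ)) := by
    intro s
    induction s using Finset.induction_on with
    | empty => simp [ex_zero]
    | insert i s hi ih => rw [Finset.sum_insert hi, Finset.prod_insert hi, ex_add, ih]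
  rw [← h, Function.comp_apply]
  congr 1
  push_cast
  rw [Finset.sum_mul]
  exact Finset.sum_congr rfl fun j _ => by ring

theorem norm_charSum_le_one (S : Multiset ℤ) (θ : ℝ) : ‖charSum S θ‖ ≤ 1 := by
  have h : ‖(S.map fun x : ℤ => ex (x * θ)).sum‖ ≤ Multiset.card S := by
    induction S using Multiset.induction_on with
    | empty => simp
    | cons a S ih =>
      rw [Multiset.map_cons, Multiset.sum_cons, Multiset.card_cons]
      refine (norm_add_le _ _).trans ?_
      rw [norm_ex]
      push_cast
      linarith
  rw [charSum, norm_div, Complex.norm_natCast]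
  exact div_le_one_of_le₀ h (Nat.cast_nonneg _)

theorem norm_charSum_sub_one_le {S : Finset ℤ} (hS : S.Nonempty) {Y : ℝ}
    (hY : ∀ x ∈ S, |(x : ℝ)| ≤ Y) (θ : ℝ) :
    ‖charSum S.val θ - 1‖ ≤ 2 * Real.pi * Y * distInt θ := by
  have hc : (0 : ℝ) < S.card := by exact_mod_cast hS.card_pos
  have hc' : (S.card : ℂ) ≠ 0 := by exact_mod_cast hS.card_pos.ne'
  have h : charSum S.val θ - 1 = (∑ x ∈ S, (ex (x * θ) - 1)) / S.card := by
    rw [charSum_finset, Finset.sum_sub_distrib, Finset.sum_const, nsmul_one, sub_div,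
      div_self hc']
  rw [h, norm_div, Complex.norm_natCast, div_le_iff₀ hc]
  refine (norm_sum_le _ _).trans ((Finset.sum_le_card_nsmul S _ _ fun x hx => ?_).trans
    (le_of_eq (by rw [nsmul_eq_mul, mul_comm])))
  refine (norm_ex_sub_one_le _).trans ?_
  rw [mul_assoc (2 * Real.pi)]
  gcongr
  exact (distInt_int_mul_le x θ).trans
    (mul_le_mul_of_nonneg_right (hY x hx) (distInt_nonneg θ))

theorem ex_sub_one_mul_sum_Icc (a : ℤ) (n : ℕ) (θ : ℝ) :
    (ex θ - 1) * ∑ m ∈ Finset.Icc a (a + n), ex (m * θ) = ex ((a + n + 1) * θ) - ex (a * θ) := by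
  induction n with
  | zero =>
    simp only [Nat.cast_zero, add_zero, Finset.Icc_self, Finset.sum_singleton]
    rw [add_mul, ex_add, one_mul]
    ring
  | succ n ih =>
    have h : Finset.Icc a (a + (n + 1 : ℕ)) = insert (a + n + 1) (Finset.Icc a (a + n)) := by
      ext x
      simp only [Finset.mem_Icc, Finset.mem_insert]
      push_cast
      omega
    have h2 : ex ((a + ((n + 1 : ℕ) : ℝ) + 1) * θ) = ex ((a + n + 1) * θ) * ex θ := by
      rw [← ex_add]
      congr 1
      push_cast
      ring
    rw [h, Finset.sum_insert (by simp), mul_add, ih, h2]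
    push_cast
    ring

theorem interval_neg_self {M : ℝ} (hM : 0 ≤ M) :
    interval (-M) M = Finset.Icc (-(⌊M⌋₊ : ℤ)) (-(⌊M⌋₊ : ℤ) + (2 * ⌊M⌋₊ : ℕ)) := by
  rw [interval, Int.ceil_neg, Int.natCast_floor_eq_floor hM]
  congr 1
  push_cast
  rw [Int.natCast_floor_eq_floor hM]
  ring

theorem interval_neg_self_nonempty {M : ℝ} (hM : 0 ≤ M) : (interval (-M) M).Nonempty :=
  ⟨0, mem_interval.2 (by simpa using hM)⟩

theorem abs_le_of_mem_interval {M : ℝ} {x : ℤ} (hx : x ∈ interval (-M) M) : |(x : ℝ)| ≤ M :=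
  abs_le.2 (mem_interval.1 hx)

theorem le_card_interval {M : ℝ} (hM : 0 ≤ M) : M ≤ (interval (-M) M).card := by
  have h := Nat.lt_floor_add_one M
  rw [interval_neg_self hM, Int.card_Icc]
  have h2 : (-(⌊M⌋₊ : ℤ) + (2 * ⌊M⌋₊ : ℕ) + 1 - -(⌊M⌋₊ : ℤ)).toNat = 2 * ⌊M⌋₊ + 1 := by omega
  rw [h2]
  push_cast
  linarith [(Nat.cast_nonneg ⌊M⌋₊ : (0 : ℝ) ≤ _)]

/-- The absolute value of the normalised Dirichlet kernel. -/
noncomputable def dirichlet (M θ : ℝ) : ℝ := ‖charSum (interval (-M) M).val θ‖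

theorem dirichlet_nonneg (M θ : ℝ) : 0 ≤ dirichlet M θ := norm_nonneg _

theorem dirichlet_le_one (M θ : ℝ) : dirichlet M θ ≤ 1 := norm_charSum_le_one _ _

theorem dirichlet_intCast {M : ℝ} (hM : 0 ≤ M) (n : ℤ) : dirichlet M n = 1 := by
  have hc : ((interval (-M) M).card : ℂ) ≠ 0 := by
    exact_mod_cast (interval_neg_self_nonempty hM).card_pos.ne'
  have h : ∀ x : ℤ, ex (x * n) = 1 := fun x => by exact_mod_cast ex_intCast (x * n)
  rw [dirichlet, charSum_finset]
  simp only [h, Finset.sum_const, nsmul_one]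
  rw [div_self hc, norm_one]

/-- The geometric series telescopes to a difference of two unit vectors after multiplication by `ex
θ - 1`, which has size at least four times the distance of θ to the integers. -/
theorem dirichlet_mul_le {M : ℝ} (hM : 0 ≤ M) (θ : ℝ) : 2 * M * distInt θ * dirichlet M θ ≤ 1 := by
  have hc : (0 : ℝ) < (interval (-M) M).card := by
    exact_mod_cast (interval_neg_self_nonempty hM).card_pos
  have h1 : ‖(ex θ - 1) * ∑ m ∈ interval (-M) M, ex (m * θ)‖ ≤ 2 := by
    rw [interval_neg_self hM, ex_sub_one_mul_sum_Icc]
    refine (norm_sub_le _ _).trans ?_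
    rw [norm_ex, norm_ex]
    norm_num
  rw [norm_mul] at h1
  have h2 : (interval (-M) M).card * dirichlet M θ = ‖∑ m ∈ interval (-M) M, ex (m * θ)‖ := by
    rw [dirichlet, charSum_finset, norm_div, Complex.norm_natCast, mul_div_cancel₀ _ hc.ne']
  rw [← h2] at h1
  have h3 := le_norm_ex_sub_one θ
  have h4 := le_card_interval hM
  have h5 := distInt_nonneg θ
  have h6 := dirichlet_nonneg M θ
  have h7 : 4 * distInt θ * (M * dirichlet M θ)
      ≤ ‖ex θ - 1‖ * ((interval (-M) M).card * dirichlet M θ) := by gcongr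
  linarith

/-! ### Plancherel and the total variation distance. -/

theorem sum_density_mul_ex {S : Multiset ℤ} {U : Finset ℤ} (hU : S.toFinset ⊆ U) (θ : ℝ) :
    ∑ x ∈ U, (density S x : ℂ) * ex (x * θ) = charSum S θ := by
  rw [charSum, Finset.sum_multiset_map_count, Finset.sum_div]
  symm
  refine Finset.sum_subset_zero_on_sdiff hU (fun x hx => ?_) fun x _ => ?_
  · rw [Finset.mem_sdiff, Multiset.mem_toFinset] at hx
    rw [density, Multiset.count_eq_zero_of_notMem hx.2]
    simp
  · rw [density, nsmul_eq_mul]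
    push_cast
    ring

theorem sum_ex_eq {N : ℕ} {n : ℤ} (hn : |n| < N) :
    ∑ ξ ∈ Finset.range N, ex (n * (ξ / N)) = if n = 0 then (N : ℂ) else 0 := by
  split_ifs with h0
  · simp [h0, ex_zero]
  have hN : 0 < N := by
    have := abs_nonneg n
    omega
  have hN' : (N : ℝ) ≠ 0 := by exact_mod_cast hN.ne'
  have h1 : ∀ ξ ∈ Finset.range N, ex (n * (ξ / N)) = ex ((n : ℝ) / N) ^ ξ := by
    intro ξ _
    rw [← ex_nat_mul]
    congr 1
    ring
  have h2 : ex ((n : ℝ) / N) ≠ 1 := by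
    intro h
    have h3 := le_norm_ex_sub_one ((n : ℝ) / N)
    have h4 := inv_le_distInt_div (b := n) hN (fun hd => h0 (Int.eq_zero_of_abs_lt_dvd hd hn))
    rw [h, sub_self, norm_zero] at h3
    have : 0 < 1 / (N : ℝ) := by positivity
    linarith
  rw [Finset.sum_congr rfl h1, geom_sum_eq h2, ← ex_nat_mul, mul_div_cancel₀ _ hN', ex_intCast,
    sub_self, zero_div]

/-- Plancherel on ℤ/(2X + 1): the points of [-X, X] are distinct modulo 2X + 1, so orthogonality
leaves only the diagonal. -/
theorem sum_norm_sq_eq (X : ℕ) (g : ℤ → ℝ) :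
    ∑ ξ ∈ Finset.range (2 * X + 1),
      ‖∑ x ∈ Finset.Icc (-(X : ℤ)) X, (g x : ℂ) * ex (x * (ξ / (2 * X + 1 : ℕ)))‖ ^ 2
      = (2 * X + 1 : ℕ) * ∑ x ∈ Finset.Icc (-(X : ℤ)) X, g x ^ 2 := by
  set N := 2 * X + 1 with hN
  set U := Finset.Icc (-(X : ℤ)) X with hU
  have key : ∀ ξ : ℕ, ((‖∑ x ∈ U, (g x : ℂ) * ex (x * (ξ / N))‖ ^ 2 : ℝ) : ℂ)
      = ∑ x ∈ U, ∑ y ∈ U, (g x * g y : ℂ) * ex (((x - y : ℤ) : ℝ) * (ξ / N)) := by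
    intro ξ
    rw [← Complex.normSq_eq_norm_sq, Complex.normSq_eq_conj_mul_self, map_sum, mul_comm,
      Finset.sum_mul_sum]
    refine Finset.sum_congr rfl fun x _ => Finset.sum_congr rfl fun y _ => ?_
    rw [map_mul, Complex.conj_ofReal, conj_ex]
    have : ex (((x - y : ℤ) : ℝ) * (ξ / N)) = ex (x * (ξ / N)) * ex (-(y * (ξ / N))) := by
      rw [← ex_add]
      congr 1
      push_cast
      ring
    rw [this]
    ring
  have : ((∑ ξ ∈ Finset.range N, ‖∑ x ∈ U, (g x : ℂ) * ex (x * (ξ / N))‖ ^ 2 : ℝ) : ℂ)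
      = ((N * ∑ x ∈ U, g x ^ 2 : ℝ) : ℂ) := by
    rw [Complex.ofReal_sum, Finset.sum_congr rfl fun ξ _ => key ξ, Finset.sum_comm]
    push_cast
    rw [Finset.mul_sum]
    refine Finset.sum_congr rfl fun x hx => ?_
    rw [Finset.sum_comm, Finset.sum_eq_single_of_mem x hx]
    · rw [← Finset.mul_sum]
      have := sum_ex_eq (N := N) (n := x - x) (by simp [hN])
      push_cast at this
      rw [this, if_pos (sub_self x)]
      ring
    · intro y hy hyx
      rw [← Finset.mul_sum]
      have hlt : |x - y| < (N : ℤ) := by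
        rw [hU, Finset.mem_Icc] at hx hy
        rw [abs_lt, hN]
        push_cast
        constructor <;> linarith [hx.1, hx.2, hy.1, hy.2]
      have := sum_ex_eq hlt
      push_cast at this
      rw [this, if_neg (sub_ne_zero.2 hyx.symm), mul_zero]
  exact_mod_cast this

/-- The total variation distance is controlled by the Fourier transform. -/
theorem tvDist_sq_le {X : ℕ} {S T : Multiset ℤ} (hS : ∀ x ∈ S, |x| ≤ X) (hT : ∀ x ∈ T, |x| ≤ X) :
    tvDist S T ^ 2 ≤ ∑ ξ ∈ Finset.range (2 * X + 1),
      ‖charSum S (ξ / (2 * X + 1 : ℕ)) - charSum T (ξ / (2 * X + 1 : ℕ))‖ ^ 2 := by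
  set U := Finset.Icc (-(X : ℤ)) X with hU
  have hSU : S.toFinset ⊆ U := fun x hx =>
    Finset.mem_Icc.2 (abs_le.1 (hS x (Multiset.mem_toFinset.1 hx)))
  have hTU : T.toFinset ⊆ U := fun x hx =>
    Finset.mem_Icc.2 (abs_le.1 (hT x (Multiset.mem_toFinset.1 hx)))
  have h1 : tvDist S T ≤ ∑ x ∈ U, |density S x - density T x| :=
    Finset.sum_le_sum_of_subset_of_nonneg (Finset.union_subset hSU hTU)
      fun _ _ _ => abs_nonneg _
  have h0 : 0 ≤ tvDist S T := Finset.sum_nonneg fun _ _ => abs_nonneg _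
  -- The loss of |U| = 2X + 1 in Cauchy–Schwarz is exactly the normalising factor in Plancherel.
  have h2 : tvDist S T ^ 2 ≤ U.card * ∑ x ∈ U, |density S x - density T x| ^ 2 :=
    (pow_le_pow_left₀ h0 h1 2).trans sq_sum_le_card_mul_sum_sq
  have h3 : U.card = 2 * X + 1 := by
    rw [hU, Int.card_Icc]
    omega
  simp_rw [sq_abs] at h2
  rw [h3, ← sum_norm_sq_eq X fun x => density S x - density T x] at h2
  refine h2.trans (le_of_eq (Finset.sum_congr rfl fun ξ _ => ?_))
  rw [← sum_density_mul_ex hSU, ← sum_density_mul_ex hTU, ← Finset.sum_sub_distrib]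
  congr 3
  funext x
  push_cast
  ring

theorem tvDist_nonneg (S T : Multiset ℤ) : 0 ≤ tvDist S T :=
  Finset.sum_nonneg fun _ _ => abs_nonneg _

theorem sum_density_le_one {S : Multiset ℤ} {U : Finset ℤ} (hU : S.toFinset ⊆ U) :
    ∑ x ∈ U, density S x ≤ 1 := by
  simp_rw [density, ← Finset.sum_div]
  refine div_le_one_of_le₀ (le_of_eq ?_) (Nat.cast_nonneg _)
  rw [← Nat.cast_sum, Multiset.sum_count_eq_card fun x hx => hU (Multiset.mem_toFinset.2 hx)]

theorem tvDist_le_two (S T : Multiset ℤ) : tvDist S T ≤ 2 := by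
  have h : ∀ (A : Multiset ℤ) (x : ℤ), 0 ≤ density A x := fun A x =>
    div_nonneg (Nat.cast_nonneg _) (Nat.cast_nonneg _)
  calc tvDist S T ≤ ∑ x ∈ S.toFinset ∪ T.toFinset, (density S x + density T x) :=
        Finset.sum_le_sum fun x _ => abs_sub_le_iff.2
          ⟨by linarith [h S x, h T x], by linarith [h S x, h T x]⟩
    _ ≤ 2 := by
        rw [Finset.sum_add_distrib]
        linarith [sum_density_le_one (S := S) (U := S.toFinset ∪ T.toFinset)
          Finset.subset_union_left, sum_density_le_one (S := T) (U := S.toFinset ∪ T.toFinset)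
          Finset.subset_union_right]

/-! ### The Weyl-type mean square estimate. -/

theorem card_piFinset_interval_pos {r : ℕ} {M : ℝ} (hM : 1 ≤ M) :
    0 < (Fintype.piFinset fun _ : Fin r => interval 1 M).card := by
  rw [Fintype.card_piFinset_const, card_interval_one]
  exact pow_pos (Nat.floor_pos.2 hM) r

/-- The mean square over a box of the Dirichlet kernel along a polynomial is small away from the
rationals with small denominators. -/
theorem exists_sum_dirichlet_sq_le (d r : ℕ) (hd : 1 ≤ d) : ∃ C : ℕ, 1 ≤ C ∧
    ∀ (A : ℝ) (P : MvPolynomial (Fin r) ℤ), 1 ≤ A → P ≠ 0 → P.totalDegree = d - 1 →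
    (∀ m, |((P.coeff m : ℤ) : ℝ)| ≤ A) → ∀ (M α : ℝ) (L : ℕ), 1 ≤ L → (L : ℝ) ^ C ≤ M →
    (∀ q : ℕ, 1 ≤ q → q ≤ L ^ C → (L : ℝ) ^ C / M ^ d < distInt (q * α)) →
    ∑ h ∈ Fintype.piFinset fun _ : Fin r => interval 1 M,
      dirichlet M ((MvPolynomial.eval h P : ℤ) * α) ^ 2
      ≤ C * A / L * (Fintype.piFinset fun _ : Fin r => interval 1 M).card := by
  obtain ⟨c, n, hc, hmain⟩ := exists_distInt_mul_le_of_dense (d - 1) r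
  -- As a factor in δ = CA/L, C ≥ 2c gives cDA ≤ L for D = 2/δ. As an exponent, C ≥ n + 1 absorbs
  -- the n further factors D ≤ L.
  refine ⟨2 * c + n + 1, by omega, ?_⟩
  intro A P hA1 hP0 hPe hA M α L hL hLM hα
  set C := 2 * c + n + 1 with hC
  set B := Fintype.piFinset fun _ : Fin r => interval 1 M with hB
  have hL1 : (1 : ℝ) ≤ L := by exact_mod_cast hL
  have hM1 : 1 ≤ M := (one_le_pow₀ hL1).trans hLM
  have hM0 : 0 < M := by linarith
  have hBpos : (0 : ℝ) < B.card := by exact_mod_cast card_piFinset_interval_pos hM1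
  by_contra! hcon
  set f : (Fin r → ℤ) → ℝ := fun h => dirichlet M ((MvPolynomial.eval h P : ℤ) * α) with hf
  have hf0 : ∀ h, 0 ≤ f h := fun h => dirichlet_nonneg _ _
  have hf1 : ∀ h, f h ≤ 1 := fun h => dirichlet_le_one _ _
  have hf2 : ∀ h, f h ^ 2 ≤ 1 := fun h => pow_le_one₀ (hf0 h) (hf1 h)
  have hcpos : (1 : ℝ) ≤ c := by exact_mod_cast hc
  have hCr : 2 * (c : ℝ) ≤ C := by rw [hC]; push_cast; linarith [(Nat.cast_nonneg n : (0 : ℝ) ≤ n)]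
  set δ : ℝ := C * A / L with hδ
  have hδ0 : 0 < δ := by
    have : (0 : ℝ) < C := by linarith
    positivity
  have hδ1 : δ < 1 := by
    have h1 : ∑ h ∈ B, f h ^ 2 ≤ B.card := by
      simpa using Finset.sum_le_card_nsmul B _ 1 fun h _ => hf2 h
    have h2 := hcon.trans_le h1
    by_contra! h3
    nlinarith
  set D : ℝ := 2 / δ with hD
  have hD1 : 1 ≤ D := by rw [hD, le_div_iff₀ hδ0]; linarith
  have hδD : δ * D = 2 := by rw [hD]; field_simp
  have hcDA : c * D * A ≤ L := by
    have hC0 : (C : ℝ) ≠ 0 := by rw [hC]; positivity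
    have h1 : D * (C * A) = 2 * L := by rw [hD, hδ]; field_simp
    have h2 : D * (2 * c * A) ≤ D * (C * A) := by gcongr
    linarith
  have hDA : 0 ≤ c * D := by positivity
  have hcD : c * D ≤ L := by nlinarith
  have hDL : D ≤ L := by nlinarith
  have hDn : D ^ n ≤ (L : ℝ) ^ n := pow_le_pow_left₀ (by linarith) hDL n
  have hLC : (L : ℝ) ^ (n + 1) ≤ L ^ C := pow_le_pow_right₀ hL1 (by omega)
  have hDn1 : c * D ^ n * D ≤ (L : ℝ) ^ C := by
    calc c * D ^ n * D = D ^ n * (c * D) := by ring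
      _ ≤ (L : ℝ) ^ n * L := by gcongr
      _ ≤ L ^ C := by rw [← pow_succ]; exact hLC
  have hDnA : c * D ^ n * A ≤ (L : ℝ) ^ C := by
    calc c * D ^ n * A ≤ c * D ^ n * A * D := le_mul_of_one_le_right (by positivity) hD1
      _ = D ^ n * (c * D * A) := by ring
      _ ≤ (L : ℝ) ^ n * L := by gcongr
      _ ≤ L ^ C := by rw [← pow_succ]; exact hLC
  have hη : c * D ^ n * (D / (2 * M)) ≤ (L : ℝ) ^ C / M := by
    rw [mul_div_assoc', div_le_div_iff₀ (by positivity) hM0]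
    have : 0 ≤ (L : ℝ) ^ C := by positivity
    nlinarith
  -- A mean square above δ forces f² ≥ δ/2 on a set of density at least δ/2 = 1/D. There f ≥ δ/2, so
  -- the kernel bound puts the phase within 1/(δM) = D/(2M) of an integer. This factor 1/M turns
  -- M^(d-1) into M^d.
  obtain ⟨q, hq1, hq2, hq3⟩ := hmain A P hP0 hPe hA M D (D / (2 * M)) α
    (B.filter fun h => δ / 2 ≤ f h ^ 2) hD1 (Finset.filter_subset _ _) (by
      have h1 : ∀ h ∈ B, f h ^ 2 ≤ (if δ / 2 ≤ f h ^ 2 then (1 : ℝ) else 0) + δ / 2 := by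
        intro h _
        split_ifs with hh
        · linarith [hf2 h]
        · linarith
      have h2 := hcon.trans_le (Finset.sum_le_sum h1)
      rw [Finset.sum_add_distrib, ← Finset.sum_filter, Finset.sum_const, Finset.sum_const,
        nsmul_eq_mul, nsmul_eq_mul, mul_one] at h2
      rw [← hB]
      nlinarith) (fun h hh => by
      have h1 := (Finset.mem_filter.1 hh).2
      have h2 : f h ^ 2 ≤ f h := by nlinarith [hf0 h, hf1 h]
      have h3 := dirichlet_mul_le hM0.le ((MvPolynomial.eval h P : ℤ) * α)
      have h4 := distInt_nonneg ((MvPolynomial.eval h P : ℤ) * α)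
      rw [mul_comm α, le_div_iff₀ (by positivity)]
      have h5 : 2 * M * distInt ((MvPolynomial.eval h P : ℤ) * α) * (δ / 2) ≤ 1 :=
        (mul_le_mul_of_nonneg_left (h1.trans h2) (by positivity)).trans h3
      nlinarith) (by
      refine hη.trans ?_
      rw [div_le_one hM0]
      exact hLM) (by
      refine le_trans ?_ (hDn1.trans hLM)
      exact le_mul_of_one_le_right (by positivity) hD1)
  have hqC : q ≤ L ^ C := by exact_mod_cast hq2.trans hDnA
  have h1 := (hα q hq1 hqC).trans_le hq3
  have h2 : c * D ^ n * (D / (2 * M)) / M ^ (d - 1) ≤ (L : ℝ) ^ C / M / M ^ (d - 1) := by gcongr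
  rw [div_div _ M, ← pow_succ', Nat.sub_add_cancel hd] at h2
  linarith

/-! ### Major arcs and sums over levels. -/

open Classical in
/-- The frequencies `ξ / N` that are within `K / W` of an integer after multiplication with some
positive integer that is at most `K`. -/
noncomputable def majorArcs (N K : ℕ) (W : ℝ) : Finset ℕ :=
  (Finset.range N).filter fun ξ =>
    ∃ q : ℕ, 1 ≤ q ∧ q ≤ K ∧ distInt (q * ((ξ : ℝ) / N)) ≤ K / W

theorem mem_majorArcs {N K : ℕ} {W : ℝ} {ξ : ℕ} : ξ ∈ majorArcs N K W ↔
    ξ < N ∧ ∃ q : ℕ, 1 ≤ q ∧ q ≤ K ∧ distInt (q * ((ξ : ℝ) / N)) ≤ K / W := by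
  simp [majorArcs]

/-- Write qξ = aN + b with a the integer nearest to qξ/N. The triple (q, a, b) determines ξ, and
there are at most K, K + 1 and 2RK + 1 choices for its entries. -/
theorem card_majorArcs_le {N K : ℕ} {W R : ℝ} (hW : 0 < W) (hK : 1 ≤ K) (hR : 1 ≤ R)
    (hN : (N : ℝ) ≤ R * W) : ((majorArcs N K W).card : ℝ) ≤ 6 * R * K ^ 3 := by
  set B := ⌊N * (K / W)⌋₊ with hB
  have hBle : (B : ℝ) ≤ R * K := by
    refine (Nat.floor_le (by positivity)).trans ?_
    rw [mul_div_assoc', div_le_iff₀ hW]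
    nlinarith [(Nat.cast_nonneg K : (0 : ℝ) ≤ K)]
  have hex : ∀ ξ ∈ majorArcs N K W, ∃ t : ℕ × ℤ × ℤ,
      t ∈ Finset.Icc 1 K ×ˢ Finset.Icc 0 (K : ℤ) ×ˢ Finset.Icc (-(B : ℤ)) B ∧
      (t.1 : ℤ) * ξ = t.2.1 * N + t.2.2 := by
    intro ξ hξ
    obtain ⟨hξN, q, hq1, hq2, hq3⟩ := mem_majorArcs.1 hξ
    have hNpos : (0 : ℝ) < N := by exact_mod_cast (by omega : 0 < N)
    set a := round ((q : ℝ) * (ξ / N)) with ha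
    have hx0 : 0 ≤ (q : ℝ) * (ξ / N) := by positivity
    have hx1 : (q : ℝ) * (ξ / N) ≤ q := by
      refine mul_le_of_le_one_right (by positivity) ?_
      rw [div_le_one hNpos]
      exact_mod_cast hξN.le
    have hround := abs_le.1 (abs_sub_round ((q : ℝ) * (ξ / N)))
    have ha0 : 0 ≤ a := by
      have : (-1 : ℝ) < a := by linarith
      have : (-1 : ℤ) < a := by exact_mod_cast this
      omega
    have haK : a ≤ K := by
      have : (a : ℝ) < q + 1 := by linarith
      have : a < q + 1 := by exact_mod_cast this
      omega
    have hb : |((q : ℤ) * ξ - a * N : ℤ)| ≤ B := by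
      have h1 : (((q : ℤ) * ξ - a * N : ℤ) : ℝ) = N * ((q : ℝ) * (ξ / N) - a) := by
        push_cast
        field_simp
      have h2 : |(((q : ℤ) * ξ - a * N : ℤ) : ℝ)| ≤ N * (K / W) := by
        rw [h1, abs_mul, abs_of_pos hNpos]
        gcongr
        exact hq3
      have h3 : ((q : ℤ) * ξ - a * N).natAbs ≤ B := by
        refine Nat.le_floor ?_
        rw [Nat.cast_natAbs, Int.cast_abs]
        exact h2
      rw [Int.abs_eq_natAbs]
      exact_mod_cast h3
    refine ⟨(q, a, q * ξ - a * N), ?_, by simp⟩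
    simp only [Finset.mem_product, Finset.mem_Icc]
    exact ⟨⟨hq1, hq2⟩, ⟨ha0, haK⟩, abs_le.1 hb⟩
  choose! t ht using hex
  have hcard := Finset.card_le_card_of_injOn t (fun ξ hξ => (ht ξ hξ).1) (fun ξ hξ ξ' hξ' h => by
    have h1 := (ht ξ hξ).2
    have h2 := (ht ξ' hξ').2
    rw [h, ← h2] at h1
    have h3 : 1 ≤ (t ξ').1 := by
      have := (ht ξ' hξ').1
      rw [Finset.mem_product, Finset.mem_Icc] at this
      exact this.1.1
    have h4 : ((t ξ').1 : ℤ) ≠ 0 := by omega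
    exact_mod_cast mul_left_cancel₀ h4 h1)
  rw [Finset.card_product, Finset.card_product, Nat.card_Icc, Int.card_Icc, Int.card_Icc,
    add_tsub_cancel_right] at hcard
  have h1 : ((K : ℤ) + 1 - 0).toNat = K + 1 := by omega
  have h2 : ((B : ℤ) + 1 - -B).toNat = 2 * B + 1 := by omega
  rw [h1, h2] at hcard
  have hK' : (1 : ℝ) ≤ K := by exact_mod_cast hK
  calc ((majorArcs N K W).card : ℝ) ≤ ((K * ((K + 1) * (2 * B + 1)) : ℕ) : ℝ) := by
        exact_mod_cast hcard
    _ = K * ((K + 1) * (2 * B + 1)) := by push_cast; ring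
    _ ≤ K * ((2 * K) * (3 * (R * K))) := by
        gcongr
        · linarith
        · nlinarith
    _ = 6 * R * K ^ 3 := by ring

/-- Summing a function over the complements of a growing family of sets. -/
theorem sum_le_sum_card_mul {F f : ℕ → ℝ} {B E : ℕ → Finset ℕ} (hF : ∀ ξ, 0 ≤ F ξ)
    (hf : ∀ L, 0 ≤ f L) {L₀ L₁ : ℕ} (hL : L₀ ≤ L₁)
    (hE : ∀ L, B L \ B (L + 1) ⊆ E (L + 1))
    (hFf : ∀ L, L₀ ≤ L → L ≤ L₁ → ∀ ξ ∈ B L, F ξ ≤ f L) :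
    ∑ ξ ∈ B L₀, F ξ ≤ ∑ L ∈ Finset.Ico L₀ L₁, (E (L + 1)).card * f L + (B L₁).card * f L₁ := by
  have key : ∀ n, L₀ ≤ n → n ≤ L₁ → ∑ ξ ∈ B L₀, F ξ ≤
      ∑ L ∈ Finset.Ico L₀ n, (E (L + 1)).card * f L + ∑ ξ ∈ B n, F ξ := by
    intro n hn
    induction n, hn using Nat.le_induction with
    | base => simp
    | succ n hn ih =>
      intro hn1
      refine (ih (by omega)).trans ?_
      rw [Finset.sum_Ico_succ_top hn, add_assoc]
      gcongr
      have h1 : ∑ ξ ∈ B n, F ξ ≤ ∑ ξ ∈ (B n \ B (n + 1)) ∪ B (n + 1), F ξ :=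
        Finset.sum_le_sum_of_subset_of_nonneg (by simp) fun _ _ _ => hF _
      rw [Finset.sum_union Finset.sdiff_disjoint] at h1
      refine h1.trans (add_le_add_left ?_ _)
      refine (Finset.sum_le_card_nsmul _ _ (f n) fun ξ hξ =>
        hFf n hn (by omega) ξ (Finset.mem_sdiff.1 hξ).1).trans ?_
      rw [nsmul_eq_mul]
      gcongr
      · exact hf n
      · exact hE n
  refine (key L₁ hL le_rfl).trans ?_
  gcongr
  refine (Finset.sum_le_card_nsmul _ _ (f L₁) (hFf L₁ hL le_rfl)).trans (le_of_eq ?_)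
  rw [nsmul_eq_mul]

/-! ### The choice of q, the major arcs and the exceptional set. -/

/-- If integers have no common divisor in `(K, K ^ 2]`, then their common divisors up to `K` all
divide one of them. -/
theorem exists_dvd_of_forall_dvd {k : ℕ} {a : Fin k → ℤ} {K : ℕ} (hK : 1 ≤ K)
    (h : ∀ l : ℕ, K < l → l ≤ K ^ 2 → ¬ ∀ j, (l : ℤ) ∣ a j) :
    ∃ q : ℕ, 1 ≤ q ∧ q ≤ K ∧ ∀ p : ℕ, 1 ≤ p → p ≤ K → (∀ j, (p : ℤ) ∣ a j) → p ∣ q := by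
  classical
  have hne : ((Finset.Icc 1 K).filter fun q : ℕ => ∀ j, (q : ℤ) ∣ a j).Nonempty :=
    ⟨1, Finset.mem_filter.2 ⟨Finset.mem_Icc.2 ⟨le_rfl, hK⟩, fun j => by simp⟩⟩
  -- For a common divisor p ≤ K, lcm(p, q) is a common divisor of size at most K². It avoids (K,
  -- K²], so it is at most K, and maximality of q gives lcm(p, q) = q.
  obtain ⟨q, hq, hmax⟩ := Finset.exists_max_image _ id hne
  rw [Finset.mem_filter, Finset.mem_Icc] at hq
  refine ⟨q, hq.1.1, hq.1.2, fun p hp1 hpK hp => ?_⟩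
  have hlcm : ∀ j, ((Nat.lcm p q : ℕ) : ℤ) ∣ a j := fun j => by
    have := Int.natCast_dvd.1 (hp j)
    rw [Int.natCast_dvd]
    exact Nat.lcm_dvd this (Int.natCast_dvd.1 (hq.2 j))
  have hle2 : Nat.lcm p q ≤ K ^ 2 := by
    refine (Nat.le_of_dvd (Nat.mul_pos hp1 hq.1.1) (Nat.lcm_dvd_mul p q)).trans ?_
    rw [sq]
    exact Nat.mul_le_mul hpK hq.1.2
  have hle : Nat.lcm p q ≤ K := by
    by_contra! hlt
    exact h _ hlt hle2 hlcm
  have hpos : 1 ≤ Nat.lcm p q := Nat.lcm_pos hp1 hq.1.1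
  have := hmax (Nat.lcm p q) (Finset.mem_filter.2 ⟨Finset.mem_Icc.2 ⟨hpos, hle⟩, hlcm⟩)
  have heq : Nat.lcm p q = q :=
    le_antisymm this (Nat.le_of_dvd hpos (Nat.dvd_lcm_right p q))
  rw [← heq]
  exact Nat.dvd_lcm_left p q

theorem norm_charSum_progression {k : ℕ} (a : Fin k → ℤ) (M θ : ℝ) :
    ‖charSum (progression a M) θ‖ = ∏ j, dirichlet M (a j * θ) := by
  rw [charSum_progression, norm_prod]
  rfl

/-- On the major arcs, either the progression has a small Fourier coefficient or the short
progression has a Fourier coefficient close to `1`. -/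
theorem norm_charSum_major_le {k K q : ℕ} {a : Fin k → ℤ} {M W V Y θ : ℝ} (hM : 0 < M)
    (hY : 0 ≤ Y) (hK : 1 ≤ K) (hqK : q ≤ K)
    (hq : ∀ p : ℕ, 1 ≤ p → p ≤ K → (∀ j, (p : ℤ) ∣ a j) → p ∣ q)
    (ha : ∀ j, |(a j : ℝ)| ≤ V) (hV : V * (K / W) ≤ 1 / (2 * K))
    (hθ : ∃ p : ℕ, 1 ≤ p ∧ p ≤ K ∧ distInt (p * θ) ≤ K / W) :
    ‖charSum (progression a M) θ‖ ^ 2 * ‖charSum (interval (-Y) Y).val (q * θ) - 1‖ ^ 2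
      ≤ (2 * Real.pi * Y * (K * (K / W))) ^ 2 + 4 * (K / M) ^ 2 := by
  obtain ⟨p₀, hp₀1, hp₀K, hp₀⟩ := hθ
  have hK0 : (0 : ℝ) < K := by exact_mod_cast hK
  have hg : 0 < Int.gcd (p₀ : ℤ) (round ((p₀ : ℝ) * θ)) := Int.gcd_pos_of_ne_zero_left _ (by omega)
  -- Passing to lowest terms only shrinks the error, and coprimality of b and p is what lets p ∤ a_j
  -- imply p ∤ a_j b.
  obtain ⟨p', b, hcop, hp', hb⟩ := Int.exists_gcd_one hg
  set g := Int.gcd (p₀ : ℤ) (round ((p₀ : ℝ) * θ)) with hgdef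
  have hg0 : (0 : ℤ) < g := by exact_mod_cast hg
  have hp'pos : 0 < p' := by
    by_contra! h
    have : (p₀ : ℤ) ≤ 0 := by rw [hp']; exact mul_nonpos_of_nonpos_of_nonneg h hg0.le
    omega
  lift p' to ℕ using hp'pos.le with p
  have hp1 : 1 ≤ p := by exact_mod_cast hp'pos
  have hg1 : (1 : ℝ) ≤ g := by exact_mod_cast hg
  have hpp₀ : p ≤ p₀ := by
    have : (p : ℤ) ≤ p₀ := by rw [hp']; nlinarith
    exact_mod_cast this
  have hpK := hpp₀.trans hp₀K
  have hp0 : (0 : ℝ) < p := by exact_mod_cast hp1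
  have hpKr : (p : ℝ) ≤ K := by exact_mod_cast hpK
  have hβ : |(p : ℝ) * θ - b| ≤ K / W := by
    have h1 : (p₀ : ℝ) * θ - round ((p₀ : ℝ) * θ) = g * ((p : ℝ) * θ - b) := by
      have h2 : (p₀ : ℝ) = p * g := by exact_mod_cast hp'
      have h3 : ((round ((p₀ : ℝ) * θ) : ℤ) : ℝ) = b * g := by exact_mod_cast hb
      rw [h3, h2]
      ring
    rw [distInt, h1, abs_mul, abs_of_pos (by linarith)] at hp₀
    exact (le_mul_of_one_le_left (abs_nonneg _) hg1).trans hp₀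
  have hn1 := norm_charSum_le_one (progression a M) θ
  have hn0 := norm_nonneg (charSum (progression a M) θ)
  have hm0 := norm_nonneg (charSum (interval (-Y) Y).val (q * θ) - 1)
  by_cases hdvd : ∀ j, (p : ℤ) ∣ a j
  · obtain ⟨t, ht⟩ := hq p hp1 hpK hdvd
    have h1 : distInt (q * θ) ≤ K * (K / W) := by
      have h2 : (q : ℝ) * θ = t * (p * θ) := by rw [ht]; push_cast; ring
      rw [h2]
      refine (distInt_nat_mul_le _ _).trans ?_
      have ht' : (t : ℝ) ≤ K := by
        have : t ≤ q := by rw [ht]; exact Nat.le_mul_of_pos_left t hp1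
        exact_mod_cast this.trans hqK
      exact mul_le_mul ht' ((distInt_le _ b).trans hβ) (distInt_nonneg _) hK0.le
    have h2 := norm_charSum_sub_one_le (interval_neg_self_nonempty hY)
      (fun x hx => abs_le_of_mem_interval hx) (q * θ)
    have h3 : ‖charSum (interval (-Y) Y).val (q * θ) - 1‖ ≤ 2 * Real.pi * Y * (K * (K / W)) :=
      h2.trans (by gcongr)
    have h4 : ‖charSum (progression a M) θ‖ ^ 2 ≤ 1 := pow_le_one₀ hn0 hn1
    calc _ ≤ 1 * (2 * Real.pi * Y * (K * (K / W))) ^ 2 := by gcongr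
      _ ≤ _ := by rw [one_mul]; exact le_add_of_nonneg_right (by positivity)
  -- Here a_j b/p is at least 1/p away from the integers, and by `hV` replacing b/p by θ costs at
  -- most 1/(2p). A distance of at least 1/(2K) remains.
  · push Not at hdvd
    obtain ⟨j, hj⟩ := hdvd
    have hjb : ¬ (p : ℤ) ∣ a j * b := fun h =>
      hj ((Int.isCoprime_iff_gcd_eq_one.2 hcop).dvd_of_dvd_mul_right h)
    have h1 := inv_le_distInt_div hp1 hjb
    have h2 : ((a j * b : ℤ) : ℝ) / p = a j * θ - a j * ((p : ℝ) * θ - b) / p := by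
      push_cast
      field_simp
      ring
    rw [h2] at h1
    have h3 := distInt_sub_le (a j * θ) (a j * ((p : ℝ) * θ - b) / p)
    have h4 : distInt (a j * ((p : ℝ) * θ - b) / p) ≤ 1 / (2 * p) := by
      refine (distInt_le_abs _).trans ?_
      rw [abs_div, abs_of_pos hp0, abs_mul, div_le_div_iff₀ hp0 (by positivity)]
      have h5 : |(a j : ℝ)| * |(p : ℝ) * θ - b| ≤ V * (K / W) :=
        mul_le_mul (ha j) hβ (abs_nonneg _) ((abs_nonneg _).trans (ha j))
      have h6 : 1 / (2 * (K : ℝ)) ≤ 1 / 2 := by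
        have : (1 : ℝ) ≤ K := by exact_mod_cast hK
        gcongr
        linarith
      nlinarith
    have h5 : 1 / (2 * (K : ℝ)) ≤ distInt (a j * θ) := by
      have h6 : 1 / (p : ℝ) = 1 / (2 * p) + 1 / (2 * p) := by field_simp; norm_num
      have h7 : 1 / (2 * (K : ℝ)) ≤ 1 / (2 * p) := by gcongr
      linarith
    have h6 : dirichlet M (a j * θ) ≤ K / M := by
      have h7 := dirichlet_mul_le hM.le (a j * θ)
      have h8 := dirichlet_nonneg M (a j * θ)
      have h9 : 2 * M * (1 / (2 * (K : ℝ))) * dirichlet M (a j * θ) ≤ 1 :=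
        le_trans (by gcongr) h7
      rw [le_div_iff₀ hM]
      have h10 : 2 * M * (1 / (2 * (K : ℝ))) * dirichlet M (a j * θ)
          = dirichlet M (a j * θ) * M / K := by field_simp
      rw [h10, div_le_one hK0] at h9
      exact h9
    have h7 : ‖charSum (progression a M) θ‖ ≤ K / M := by
      rw [norm_charSum_progression, ← Finset.mul_prod_erase _ _ (Finset.mem_univ j)]
      refine le_trans (mul_le_of_le_one_right (dirichlet_nonneg _ _) ?_) h6
      exact Finset.prod_le_one (fun _ _ => dirichlet_nonneg _ _) fun _ _ => dirichlet_le_one _ _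
    have h8 : ‖charSum (interval (-Y) Y).val (q * θ) - 1‖ ≤ 2 := by
      refine (norm_sub_le _ _).trans ?_
      rw [norm_one]
      linarith [norm_charSum_le_one (interval (-Y) Y).val (q * θ)]
    calc _ ≤ (K / M) ^ 2 * 2 ^ 2 := by gcongr
      _ = 4 * (K / M) ^ 2 := by ring
      _ ≤ _ := le_add_of_nonneg_left (by positivity)

/-- The components of h range independently over the box. This is the source of the k-th power
saving. -/
theorem sum_box_prod_le {r k : ℕ} {M δ : ℝ} {g : Fin k → (Fin r → ℤ) → ℝ}
    (hg : ∀ j x, 0 ≤ g j x)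
    (h : ∀ j, ∑ x ∈ Fintype.piFinset fun _ : Fin r => interval 1 M, g j x
      ≤ δ * (Fintype.piFinset fun _ : Fin r => interval 1 M).card) :
    ∑ h ∈ box r k M, ∏ j, g j (h j) ≤ δ ^ k * (box r k M).card := by
  rw [box, ← Finset.prod_univ_sum, Fintype.card_piFinset_const]
  refine (Finset.prod_le_prod (fun j _ => Finset.sum_nonneg fun x _ => hg j x)
    fun j _ => h j).trans (le_of_eq ?_)
  rw [Finset.prod_const, Finset.card_univ, Fintype.card_fin, mul_pow]
  push_cast
  rfl

open Classical in
/-- The polynomial values at a random point rarely have a common divisor in `(K, K ^ 2]`. -/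
theorem card_common_divisor_le {r k K : ℕ} {P : Fin k → MvPolynomial (Fin r) ℤ} {M δ : ℝ}
    (hM : 0 ≤ M) (hδ : 0 ≤ δ)
    (h : ∀ j, ∀ l : ℕ, K < l → l ≤ K ^ 2 →
      ∑ x ∈ Fintype.piFinset fun _ : Fin r => interval 1 M,
        dirichlet M ((MvPolynomial.eval x (P j) : ℤ) * (1 / (l : ℝ))) ^ 2
        ≤ δ * (Fintype.piFinset fun _ : Fin r => interval 1 M).card) :
    (((box r k M).filter fun h => ∃ l : ℕ, K < l ∧ l ≤ K ^ 2 ∧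
      ∀ j, (l : ℤ) ∣ MvPolynomial.eval (h j) (P j)).card : ℝ)
      ≤ K ^ 2 * δ ^ k * (box r k M).card := by
  set E : ℕ → Finset (Fin k → Fin r → ℤ) := fun l =>
    (box r k M).filter fun h => ∀ j, (l : ℤ) ∣ MvPolynomial.eval (h j) (P j) with hE
  have hsub : ((box r k M).filter fun h => ∃ l : ℕ, K < l ∧ l ≤ K ^ 2 ∧
      ∀ j, (l : ℤ) ∣ MvPolynomial.eval (h j) (P j)) ⊆ (Finset.Ioc K (K ^ 2)).biUnion E := by
    intro x hx
    rw [Finset.mem_filter] at hx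
    obtain ⟨hx, l, hl1, hl2, hl⟩ := hx
    exact Finset.mem_biUnion.2 ⟨l, Finset.mem_Ioc.2 ⟨hl1, hl2⟩, Finset.mem_filter.2 ⟨hx, hl⟩⟩
  have hEl : ∀ l ∈ Finset.Ioc K (K ^ 2), ((E l).card : ℝ) ≤ δ ^ k * (box r k M).card := by
    intro l hl
    rw [Finset.mem_Ioc] at hl
    have hl0 : (l : ℝ) ≠ 0 := by
      have : l ≠ 0 := by omega
      exact_mod_cast this
    -- The product of squared kernels at 1/l dominates the indicator of the event: if l divides
    -- every value, each factor equals 1.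
    refine le_trans ?_ (sum_box_prod_le (fun j x => sq_nonneg _) fun j => h j l hl.1 hl.2)
    rw [hE, Finset.card_filter]
    push_cast
    refine Finset.sum_le_sum fun x _ => ?_
    split_ifs with hx
    · rw [Finset.prod_eq_one]
      intro j _
      obtain ⟨t, ht⟩ := hx j
      have : ((MvPolynomial.eval (x j) (P j) : ℤ) : ℝ) * (1 / (l : ℝ)) = t := by
        rw [ht]
        push_cast
        field_simp
      rw [this, dirichlet_intCast hM, one_pow]
    · exact Finset.prod_nonneg fun j _ => sq_nonneg _
  have h1 : (((box r k M).filter fun h => ∃ l : ℕ, K < l ∧ l ≤ K ^ 2 ∧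
      ∀ j, (l : ℤ) ∣ MvPolynomial.eval (h j) (P j)).card : ℝ)
      ≤ ∑ l ∈ Finset.Ioc K (K ^ 2), ((E l).card : ℝ) := by
    exact_mod_cast (Finset.card_le_card hsub).trans Finset.card_biUnion_le
  refine h1.trans ((Finset.sum_le_card_nsmul _ _ _ hEl).trans ?_)
  rw [nsmul_eq_mul, Nat.card_Ioc, mul_assoc]
  gcongr
  exact_mod_cast Nat.sub_le _ _

theorem abs_progression_le {k : ℕ} {a : Fin k → ℤ} {M V : ℝ} (ha : ∀ j, |(a j : ℝ)| ≤ V) {x : ℤ}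
    (hx : x ∈ progression a M) : |(x : ℝ)| ≤ k * (V * M) := by
  rw [progression, Multiset.mem_map] at hx
  obtain ⟨m, hm, rfl⟩ := hx
  rw [Finset.mem_val, Fintype.mem_piFinset] at hm
  push_cast
  refine (Finset.abs_sum_le_sum_abs _ _).trans ?_
  have h : ∀ j ∈ Finset.univ, |(a j : ℝ) * m j| ≤ V * M := fun j _ => by
    rw [abs_mul]
    exact mul_le_mul (ha j) (abs_le_of_mem_interval (hm j)) (abs_nonneg _)
      ((abs_nonneg _).trans (ha j))
  simpa using Finset.sum_le_card_nsmul _ _ _ h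

/-! ### From the distance to Fourier coefficients, and the minor arcs. -/

/-- The total variation distance between a progression and its sum with a suitable short
progression, in terms of the Fourier coefficients on the minor arcs. -/
theorem exists_tvDist_sq_le {k K X : ℕ} {a : Fin k → ℤ} {M W V Y : ℝ} (hM : 0 < M)
    (hY : 0 ≤ Y) (hK : 1 ≤ K)
    (hdvd : ∀ l : ℕ, K < l → l ≤ K ^ 2 → ¬ ∀ j, (l : ℤ) ∣ a j)
    (ha : ∀ j, |(a j : ℝ)| ≤ V) (hV : V * (K / W) ≤ 1 / (2 * K))
    (hX : k * (V * M) + K * Y ≤ X) :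
    ∃ q : ℕ, 1 ≤ q ∧ q ≤ K ∧
      tvDist (progression a M)
        (sumMultiset (progression a M) (dilate (q : ℤ) (interval (-Y) Y).val)) ^ 2 ≤
      4 * ∑ ξ ∈ Finset.range (2 * X + 1) \ majorArcs (2 * X + 1) K W,
        ∏ j, dirichlet M (a j * (ξ / (2 * X + 1 : ℕ))) ^ 2
      + (majorArcs (2 * X + 1) K W).card *
        ((2 * Real.pi * Y * (K * (K / W))) ^ 2 + 4 * (K / M) ^ 2) := by
  obtain ⟨q, hq1, hqK, hq⟩ := exists_dvd_of_forall_dvd hK hdvd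
  refine ⟨q, hq1, hqK, ?_⟩
  set N := 2 * X + 1 with hN
  have hqK' : (q : ℝ) ≤ K := by exact_mod_cast hqK
  have hQ : ∀ x ∈ progression a M, |(x : ℝ)| ≤ k * (V * M) := fun x hx =>
    abs_progression_le ha hx
  have hQX : ∀ x ∈ progression a M, |x| ≤ X := by
    intro x hx
    have : |(x : ℝ)| ≤ X := (hQ x hx).trans (by nlinarith [mul_nonneg (Nat.cast_nonneg K) hY])
    exact_mod_cast this
  have hQ'X : ∀ x ∈ sumMultiset (progression a M) (dilate (q : ℤ) (interval (-Y) Y).val),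
      |x| ≤ X := by
    intro x hx
    rw [sumMultiset, Multiset.mem_map] at hx
    obtain ⟨⟨y, z⟩, hyz, rfl⟩ := hx
    rw [Multiset.mem_product, dilate, Multiset.mem_map] at hyz
    obtain ⟨hy, w, hw, hwz⟩ := hyz
    simp only at hy hwz
    have h1 : |(z : ℝ)| ≤ K * Y := by
      rw [← hwz]
      push_cast
      rw [abs_mul, Nat.abs_cast]
      exact mul_le_mul hqK' (abs_le_of_mem_interval hw) (abs_nonneg _) (Nat.cast_nonneg _)
    have h2 : |((y + z : ℤ) : ℝ)| ≤ X := by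
      push_cast
      exact (abs_add_le _ _).trans ((add_le_add (hQ y hy) h1).trans hX)
    exact_mod_cast h2
  refine (tvDist_sq_le hQX hQ'X).trans ?_
  have hterm : ∀ θ : ℝ, ‖charSum (progression a M) θ - charSum (sumMultiset (progression a M)
      (dilate (q : ℤ) (interval (-Y) Y).val)) θ‖ ^ 2
      = ‖charSum (progression a M) θ‖ ^ 2 * ‖charSum (interval (-Y) Y).val (q * θ) - 1‖ ^ 2 := by
    intro θ
    rw [charSum_sumMultiset, charSum_dilate, Int.cast_natCast, ← mul_pow, ← norm_mul,
      ← norm_neg, mul_sub, mul_one, neg_sub]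
  simp_rw [hterm]
  have hsub : majorArcs N K W ⊆ Finset.range N := fun ξ hξ =>
    Finset.mem_range.2 (mem_majorArcs.1 hξ).1
  rw [← Finset.sum_sdiff hsub]
  refine add_le_add ?_ ?_
  · rw [Finset.mul_sum]
    refine Finset.sum_le_sum fun ξ _ => ?_
    rw [norm_charSum_progression, Finset.prod_pow, mul_comm]
    gcongr
    have : ‖charSum (interval (-Y) Y).val (q * (ξ / N)) - 1‖ ≤ 2 := by
      refine (norm_sub_le _ _).trans ?_
      rw [norm_one]
      linarith [norm_charSum_le_one (interval (-Y) Y).val (q * (ξ / N))]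
    nlinarith [norm_nonneg (charSum (interval (-Y) Y).val (q * (ξ / N)) - 1)]
  · rw [← nsmul_eq_mul]
    exact Finset.sum_le_card_nsmul _ _ _ fun ξ hξ =>
      norm_charSum_major_le hM hY hK hqK hq ha hV (mem_majorArcs.1 hξ).2

/-- From c² ≤ L it follows that c/L ≤ L^(-1/2), so two factors save one power of L. -/
theorem div_pow_le {c : ℝ} {L₀ L s k : ℕ} (hc : 0 ≤ c) (hcL : c ^ 2 ≤ L₀) (hL₀ : 1 ≤ L₀)
    (hL : L₀ ≤ L) (hk : 2 * s ≤ k) : (c / L) ^ k ≤ (1 / (L : ℝ)) ^ s := by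
  have hL1 : (1 : ℝ) ≤ L := by exact_mod_cast hL₀.trans hL
  have hL' : (L₀ : ℝ) ≤ L := by exact_mod_cast hL
  have h1 : c ≤ L := by nlinarith
  have h2 : c / L ≤ 1 := by rw [div_le_one (by linarith)]; exact h1
  calc (c / L) ^ k ≤ (c / L) ^ (2 * s) := pow_le_pow_of_le_one (by positivity) h2 hk
    _ = ((c / L) ^ 2) ^ s := pow_mul _ _ _
    _ ≤ (1 / (L : ℝ)) ^ s := by
        gcongr
        rw [div_pow, div_le_div_iff₀ (by positivity) (by positivity)]
        nlinarith

/-- The contribution of the minor arcs. -/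
theorem sum_minorArcs_le {r k d C N L₀ : ℕ} {P : Fin k → MvPolynomial (Fin r) ℤ} {M R c : ℝ}
    (hc : 0 ≤ c) (hC : 1 ≤ C) (hcL : c ^ 2 ≤ L₀) (hL₀ : 1 ≤ L₀) (hL₀M : (L₀ : ℝ) ^ C ≤ M)
    (hR : 1 ≤ R) (hN : (N : ℝ) ≤ R * M ^ d) (hk : 2 * (3 * C + C * d + 4) ≤ k)
    (hweyl : ∀ L : ℕ, 1 ≤ L → (L : ℝ) ^ C ≤ M → ∀ θ : ℝ,
      (∀ q : ℕ, 1 ≤ q → q ≤ L ^ C → (L : ℝ) ^ C / M ^ d < distInt (q * θ)) →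
      ∀ j, ∑ x ∈ Fintype.piFinset fun _ : Fin r => interval 1 M,
        dirichlet M ((MvPolynomial.eval x (P j) : ℤ) * θ) ^ 2
        ≤ c / L * (Fintype.piFinset fun _ : Fin r => interval 1 M).card) :
    ∑ ξ ∈ Finset.range N \ majorArcs N (L₀ ^ C) (M ^ d), ∑ h ∈ box r k M,
      ∏ j, dirichlet M ((MvPolynomial.eval (h j) (P j) : ℤ) * (ξ / N)) ^ 2
      ≤ 13 * R * 2 ^ (3 * C + C * d) / (L₀ : ℝ) ^ 2 * (box r k M).card := by
  -- 3C pays for counting the arcs of one level and Cd for counting all frequencies at the last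
  -- level. Of the remaining 4, two make the sum over L converge and two give L₀⁻².
  set s := 3 * C + C * d + 4 with hs
  have hL₀1 : (1 : ℝ) ≤ L₀ := by exact_mod_cast hL₀
  have hM1 : 1 ≤ M := (one_le_pow₀ hL₀1).trans hL₀M
  have hexL : ∃ L : ℕ, M < ((L : ℝ) + 1) ^ C := by
    obtain ⟨L, hL⟩ := exists_nat_gt M
    refine ⟨L, ?_⟩
    have : (L : ℝ) + 1 ≤ ((L : ℝ) + 1) ^ C :=
      le_self_pow₀ (by linarith [(Nat.cast_nonneg L : (0 : ℝ) ≤ L)]) (by omega)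
    linarith
  classical
  -- L₁ is the last level at which the Weyl estimate is available. The frequencies still left are
  -- counted trivially by N ≤ R M^d, and M < (L₁ + 1)^C turns this into a power of L₁.
  obtain ⟨L₁, hL₁, hmin⟩ : ∃ L₁ : ℕ, M < ((L₁ : ℝ) + 1) ^ C ∧
      ∀ L < L₁, ((L : ℝ) + 1) ^ C ≤ M :=
    ⟨Nat.find hexL, Nat.find_spec hexL, fun L hL => not_lt.1 (Nat.find_min hexL hL)⟩
  have hL₀₁ : L₀ ≤ L₁ := by
    by_contra! h
    have h1 : (L₁ : ℝ) + 1 ≤ L₀ := by exact_mod_cast h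
    have h2 : ((L₁ : ℝ) + 1) ^ C ≤ (L₀ : ℝ) ^ C := by gcongr
    linarith
  have hL₁M : (L₁ : ℝ) ^ C ≤ M := by
    have := hmin (L₁ - 1) (by omega)
    rwa [Nat.cast_sub (hL₀.trans hL₀₁), Nat.cast_one, sub_add_cancel] at this
  have hpos : ∀ ξ, 0 ≤ ∑ h ∈ box r k M,
      ∏ j, dirichlet M ((MvPolynomial.eval (h j) (P j) : ℤ) * ((ξ : ℕ) / (N : ℝ))) ^ 2 :=
    fun ξ => Finset.sum_nonneg fun h _ => Finset.prod_nonneg fun j _ => sq_nonneg _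
  have hmainsum := sum_le_sum_card_mul (F := fun ξ : ℕ => ∑ h ∈ box r k M,
      ∏ j, dirichlet M ((MvPolynomial.eval (h j) (P j) : ℤ) * (ξ / N)) ^ 2)
    (f := fun L => (1 / (L : ℝ)) ^ s * (box r k M).card)
    (B := fun L => Finset.range N \ majorArcs N (L ^ C) (M ^ d))
    (E := fun L => majorArcs N (L ^ C) (M ^ d)) hpos (fun L => by positivity) hL₀₁
    (fun L ξ hξ => by
      simp only [Finset.mem_sdiff, not_and, not_not] at hξ
      exact hξ.2 hξ.1.1)
    (fun L hL hL' ξ hξ => by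
      have hLL₁ : (L : ℝ) ≤ L₁ := by exact_mod_cast hL'
      rw [Finset.mem_sdiff, Finset.mem_range, mem_majorArcs] at hξ
      refine (sum_box_prod_le (δ := c / L) (fun j x => sq_nonneg _) fun j =>
        hweyl L (hL₀.trans hL) (le_trans (by gcongr) hL₁M) _ (fun q hq1 hq2 => ?_) j).trans ?_
      · by_contra! hcon
        exact hξ.2 ⟨hξ.1, q, hq1, hq2, by push_cast; exact hcon⟩
      · gcongr
        exact div_pow_le hc hcL hL₀ hL hk)
  refine hmainsum.trans ?_
  have hinv : ∀ L : ℕ, L₀ ≤ L → (1 / (L : ℝ)) ^ 2 ≤ 1 / (L₀ : ℝ) ^ 2 := by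
    intro L hL
    have : (L₀ : ℝ) ≤ L := by exact_mod_cast hL
    rw [one_div_pow]
    gcongr
  have hcancel : ∀ L n m : ℕ, L₀ ≤ L → n + m ≤ s →
      (L : ℝ) ^ n * (1 / (L : ℝ)) ^ s ≤ (1 / (L : ℝ)) ^ m := by
    intro L n m hL hnm
    have hL1 : (1 : ℝ) ≤ L := by exact_mod_cast hL₀.trans hL
    have h1 : 1 / (L : ℝ) ≤ 1 := by rw [div_le_one (by linarith)]; exact hL1
    calc (L : ℝ) ^ n * (1 / (L : ℝ)) ^ s ≤ (L : ℝ) ^ n * (1 / (L : ℝ)) ^ (n + m) := by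
          gcongr ?_ * ?_
          exact pow_le_pow_of_le_one (by positivity) h1 hnm
      _ = (1 / (L : ℝ)) ^ m := by
          rw [pow_add, ← mul_assoc, ← mul_pow, mul_one_div_cancel (by linarith), one_pow, one_mul]
  have hMd : 0 < M ^ d := by positivity
  have hterm : ∀ L ∈ Finset.Ico L₀ L₁, ((majorArcs N ((L + 1) ^ C) (M ^ d)).card : ℝ) *
      ((1 / (L : ℝ)) ^ s * (box r k M).card) ≤
      6 * R * 2 ^ (3 * C) * (1 / (L₀ : ℝ) ^ 2) * (box r k M).card * ((L : ℝ) ^ 2)⁻¹ := by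
    intro L hL
    have hL' := (Finset.mem_Ico.1 hL).1
    have hL1 : (1 : ℝ) ≤ L := by exact_mod_cast hL₀.trans hL'
    have h1 := card_majorArcs_le (N := N) (K := (L + 1) ^ C) hMd (Nat.one_le_pow _ _ (by omega))
      hR hN
    have h2 : (((L + 1) ^ C : ℕ) : ℝ) ^ 3 ≤ 2 ^ (3 * C) * (L : ℝ) ^ (3 * C) := by
      push_cast
      rw [← pow_mul, mul_comm C 3, ← mul_pow]
      gcongr
      linarith
    calc ((majorArcs N ((L + 1) ^ C) (M ^ d)).card : ℝ) * ((1 / (L : ℝ)) ^ s * (box r k M).card)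
        ≤ (6 * R * (2 ^ (3 * C) * (L : ℝ) ^ (3 * C))) * ((1 / (L : ℝ)) ^ s * (box r k M).card) := by
          gcongr
          exact h1.trans (by gcongr)
      _ = 6 * R * 2 ^ (3 * C) * ((L : ℝ) ^ (3 * C) * (1 / (L : ℝ)) ^ s) * (box r k M).card := by
          ring
      _ ≤ 6 * R * 2 ^ (3 * C) * (1 / (L : ℝ)) ^ (2 + 2) * (box r k M).card := by
          gcongr
          exact hcancel L _ _ hL' (by omega)
      _ = 6 * R * 2 ^ (3 * C) * ((1 / (L : ℝ)) ^ 2 * (1 / (L : ℝ)) ^ 2) * (box r k M).card := by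
          rw [pow_add]
      _ ≤ 6 * R * 2 ^ (3 * C) * ((1 / (L₀ : ℝ) ^ 2) * (1 / (L : ℝ)) ^ 2) * (box r k M).card := by
          gcongr
          exact hinv L hL'
      _ = _ := by
          rw [one_div_pow, one_div ((L : ℝ) ^ 2)]
          ring
  have hsum2 : ∑ L ∈ Finset.Ico L₀ L₁, ((L : ℝ) ^ 2)⁻¹ ≤ 2 := by
    have h1 := sum_Ioo_inv_sq_le (α := ℝ) 0 L₁
    refine le_trans (Finset.sum_le_sum_of_subset_of_nonneg (fun L hL => ?_)
      fun _ _ _ => by positivity) (h1.trans (by norm_num))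
    rw [Finset.mem_Ico] at hL
    exact Finset.mem_Ioo.2 ⟨by omega, hL.2⟩
  have hlast : ((Finset.range N \ majorArcs N (L₁ ^ C) (M ^ d)).card : ℝ) *
      ((1 / (L₁ : ℝ)) ^ s * (box r k M).card) ≤
      R * 2 ^ (C * d) * (1 / (L₀ : ℝ) ^ 2) * (box r k M).card := by
    have hL1 : (1 : ℝ) ≤ L₁ := by exact_mod_cast hL₀.trans hL₀₁
    have h1 : ((Finset.range N \ majorArcs N (L₁ ^ C) (M ^ d)).card : ℝ) ≤ N := by
      have := Finset.card_le_card (Finset.sdiff_subset (s := Finset.range N)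
        (t := majorArcs N (L₁ ^ C) (M ^ d)))
      rw [Finset.card_range] at this
      exact_mod_cast this
    have h2 : M ^ d ≤ 2 ^ (C * d) * (L₁ : ℝ) ^ (C * d) := by
      calc M ^ d ≤ (((L₁ : ℝ) + 1) ^ C) ^ d := by gcongr
        _ = ((L₁ : ℝ) + 1) ^ (C * d) := (pow_mul _ _ _).symm
        _ ≤ (2 * (L₁ : ℝ)) ^ (C * d) := by gcongr; linarith
        _ = _ := mul_pow _ _ _
    calc ((Finset.range N \ majorArcs N (L₁ ^ C) (M ^ d)).card : ℝ) *
          ((1 / (L₁ : ℝ)) ^ s * (box r k M).card)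
        ≤ (R * (2 ^ (C * d) * (L₁ : ℝ) ^ (C * d))) *
          ((1 / (L₁ : ℝ)) ^ s * (box r k M).card) := by
          gcongr
          exact (h1.trans hN).trans (by gcongr)
      _ = R * 2 ^ (C * d) * ((L₁ : ℝ) ^ (C * d) * (1 / (L₁ : ℝ)) ^ s) * (box r k M).card := by
          ring
      _ ≤ R * 2 ^ (C * d) * (1 / (L₁ : ℝ)) ^ 2 * (box r k M).card := by
          gcongr
          exact hcancel L₁ _ _ hL₀₁ (by omega)
      _ ≤ _ := by
          gcongr
          exact hinv L₁ hL₀₁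
  have hfirst := Finset.sum_le_sum hterm
  rw [← Finset.mul_sum] at hfirst
  have hbox0 : (0 : ℝ) ≤ (box r k M).card := Nat.cast_nonneg _
  have h3C : (1 : ℝ) ≤ 2 ^ (3 * C) := one_le_pow₀ (by norm_num)
  have hCd : (1 : ℝ) ≤ 2 ^ (C * d) := one_le_pow₀ (by norm_num)
  refine (add_le_add (hfirst.trans (mul_le_mul_of_nonneg_left hsum2 (by positivity)))
    hlast).trans ?_
  have hfac : 6 * R * 2 ^ (3 * C) * (1 / (L₀ : ℝ) ^ 2) * (box r k M).card * 2 +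
      R * 2 ^ (C * d) * (1 / (L₀ : ℝ) ^ 2) * (box r k M).card
      = (12 * 2 ^ (3 * C) + 2 ^ (C * d)) * (R * (1 / (L₀ : ℝ) ^ 2) * (box r k M).card) := by ring
  have hfac2 : 13 * R * 2 ^ (3 * C + C * d) / (L₀ : ℝ) ^ 2 * (box r k M).card
      = 13 * 2 ^ (3 * C) * 2 ^ (C * d) * (R * (1 / (L₀ : ℝ) ^ 2) * (box r k M).card) := by
    rw [pow_add]; ring
  rw [hfac, hfac2]
  gcongr
  nlinarith

/-! ### Averaging over the box and the conclusion. -/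

/-- Membership in the box bounds the values of a polynomial. -/
theorem abs_eval_le_of_mem_box {r k d : ℕ} {P : Fin k → MvPolynomial (Fin r) ℤ} {A M : ℝ}
    (hM : 1 ≤ M) (hP : ∀ j, (P j).totalDegree = d - 1)
    (hA : ∀ j m, |(((P j).coeff m : ℤ) : ℝ)| ≤ A) {h : Fin k → Fin r → ℤ} (hh : h ∈ box r k M)
    (j : Fin k) : |((MvPolynomial.eval (h j) (P j) : ℤ) : ℝ)|
      ≤ (((d - 1 : ℕ) : ℝ) + 1) ^ r * A * M ^ (d - 1) := by
  refine abs_eval_le (hP j).le (hA j) hM fun i => ?_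
  have h1 := Fintype.mem_piFinset.1 (Fintype.mem_piFinset.1 hh j) i
  rw [mem_interval] at h1
  exact abs_le.2 ⟨by linarith [h1.1], h1.2⟩

/-- The frequencies with denominator in `(K, K ^ 2]` are far from those with denominator up to
`K`. -/
theorem lt_distInt_mul_one_div {K l q : ℕ} {W : ℝ} (hW : (K : ℝ) ^ 3 < W) (hl : K < l)
    (hl2 : l ≤ K ^ 2) (hq1 : 1 ≤ q) (hq2 : q ≤ K) : K / W < distInt (q * (1 / (l : ℝ))) := by
  have hl0 : (0 : ℝ) < l := by exact_mod_cast (by omega : 0 < l)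
  have hK0 : (0 : ℝ) < K := by exact_mod_cast (by omega : 0 < K)
  have hW0 : 0 < W := lt_trans (by positivity) hW
  have h1 : ¬ (l : ℤ) ∣ (q : ℤ) := fun h => by
    have := Nat.le_of_dvd hq1 (Int.natCast_dvd_natCast.1 h)
    omega
  have h2 := inv_le_distInt_div (by omega : 0 < l) h1
  rw [mul_one_div]
  rw [Int.cast_natCast] at h2
  refine lt_of_lt_of_le ?_ h2
  rw [div_lt_div_iff₀ hW0 hl0, one_mul]
  have h3 : (l : ℝ) ≤ (K : ℝ) ^ 2 := by exact_mod_cast hl2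
  nlinarith

theorem two_pi_sq_le : (2 * Real.pi) ^ 2 ≤ 40 := by
  have := Real.pi_lt_d2
  have := Real.pi_pos
  nlinarith

open Classical in
/-- The average over the box, in terms of the exceptional set and of the Fourier coefficients. -/
theorem expect_le_of_forall_le {r k : ℕ} {M A E : ℝ} {f m : (Fin k → Fin r → ℤ) → ℝ}
    {p : (Fin k → Fin r → ℤ) → Prop} {b c : ℝ} (hbox : 0 < (box r k M).card)
    (hA : 0 < A) (hm : ∀ h, 0 ≤ m h) (hE : 0 ≤ E) (hbad : ∀ h ∈ box r k M, p h → f h ≤ 2)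
    (hgood : ∀ h ∈ box r k M, ¬ p h → ∃ t : ℝ, f h ≤ t ∧ t ^ 2 ≤ 4 * m h + E)
    (hb : (((box r k M).filter p).card : ℝ) ≤ b * (box r k M).card)
    (hc : ∑ h ∈ box r k M, m h ≤ c * (box r k M).card) :
    𝔼 h ∈ box r k M, f h ≤ 2 * b + 2 * A * c + A * E / 2 + A⁻¹ / 2 := by
  have hbox' : (0 : ℝ) < (box r k M).card := by exact_mod_cast hbox
  rw [Finset.expect_eq_sum_div_card, div_le_iff₀ hbox']
  have h1 : ∀ h ∈ box r k M, f h ≤ 2 * (if p h then (1 : ℝ) else 0) + 2 * A * m h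
      + (A * E / 2 + A⁻¹ / 2) := by
    intro h hh
    have hA' : 0 < A⁻¹ := inv_pos.2 hA
    have hmA : 0 ≤ A * m h := mul_nonneg hA.le (hm h)
    have hEA : 0 ≤ A * E := mul_nonneg hA.le hE
    split_ifs with hp
    · have := hbad h hh hp
      linarith
    · obtain ⟨t, ht, ht2⟩ := hgood h hh hp
      -- AM–GM with weight A passes from the second moment to the first; its cost A⁻¹/2 is of the
      -- permitted order.
      have h2 : t ≤ A * t ^ 2 / 2 + A⁻¹ / 2 := by
        have h3 : A * t ^ 2 + A⁻¹ - 2 * t = A * (t - A⁻¹) ^ 2 := by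
          field_simp
          ring
        have h4 : 0 ≤ A * (t - A⁻¹) ^ 2 := by positivity
        linarith
      have h3 : A * t ^ 2 ≤ A * (4 * m h + E) := by gcongr
      linarith
  refine (Finset.sum_le_sum h1).trans ?_
  rw [Finset.sum_add_distrib, Finset.sum_add_distrib, ← Finset.mul_sum, ← Finset.mul_sum,
    Finset.sum_const, nsmul_eq_mul, ← Finset.sum_filter, Finset.sum_const, nsmul_eq_mul, mul_one]
  have h2 : 2 * A * ∑ h ∈ box r k M, m h ≤ 2 * A * (c * (box r k M).card) := by gcongr
  linarith

end GlobalSymmetry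

open GlobalSymmetry

theorem theorem2p2 (d r : ℕ) (hd : 1 ≤ d) (hr : 1 ≤ r) :
    ∃ k₀ : ℕ, ∀ k : ℕ, 1 ≤ k → k₀ ≤ k →
      ∃ A₀ C : ℝ, ∀ A : ℝ, 0 < A → A₀ ≤ A →
        ∃ M₀ : ℝ, ∀ P : Fin k → MvPolynomial (Fin r) ℤ,
          (∀ j, P j ≠ 0 ∧ (P j).totalDegree = d - 1 ∧ ∀ m, |(((P j).coeff m : ℤ) : ℝ)| ≤ A) →
          ∀ M : ℝ, 0 < M → M₀ ≤ M →
            𝔼 h ∈ GlobalSymmetry.box r k M,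
              ⨅ q : {q : ℕ // 1 ≤ q ∧ (q : ℝ) ≤ A ^ k},
                GlobalSymmetry.tvDist (GlobalSymmetry.polyProgression P M h)
                  (GlobalSymmetry.sumMultiset (GlobalSymmetry.polyProgression P M h)
                    (GlobalSymmetry.dilate ((q : ℕ) : ℤ)
                      (GlobalSymmetry.interval (-(M ^ d / A ^ (2 * k)))
                        (M ^ d / A ^ (2 * k))).val))
              ≤ C * A⁻¹ := by
  classical
  obtain ⟨C, hC, hweyl⟩ := exists_sum_dirichlet_sq_le d r hd
  refine ⟨2 * (3 * C + C * d + 4), fun k hk1 hk => ?_⟩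
  set C₂ : ℝ := (((d - 1 : ℕ) : ℝ) + 1) ^ r with hC₂
  have hC₂1 : 1 ≤ C₂ := one_le_pow₀ (by linarith [(Nat.cast_nonneg (d - 1) : (0 : ℝ) ≤ _)])
  set R₀ : ℝ := 2 * k * C₂ + 5 with hR₀
  have hCr : (1 : ℝ) ≤ C := by exact_mod_cast hC
  -- In the second constant, 5/2 is 2 for the exceptional h plus 1/2 from AM–GM; the next term comes
  -- from the minor arcs and the last from the major arcs.
  refine ⟨2 * C ^ 2 + 2 * C₂ + 2,
    5 / 2 + 26 * R₀ * 2 ^ (3 * C + C * d) + 132 * R₀, fun A hA0 hA => ?_⟩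
  have hAC : 2 * (C : ℝ) ^ 2 ≤ A := by linarith
  have hAC₂ : 2 * C₂ ≤ A := by linarith [sq_nonneg (C : ℝ)]
  have hA2 : 2 ≤ A := by linarith [sq_nonneg (C : ℝ)]
  have hA1 : 1 ≤ A := by linarith
  -- The largest power of A that M must exceed comes from K⁵A³ ≤ A^(15C + 3).
  refine ⟨A ^ (15 * C + 4), fun P hP M hM0 hM => ?_⟩
  have hApow : ∀ n m : ℕ, n ≤ m → A ^ n ≤ A ^ m := fun n m h => pow_le_pow_right₀ hA1 h
  have hMpow : ∀ n : ℕ, n ≤ 15 * C + 4 → A ^ n ≤ M := fun n h => (hApow _ _ h).trans hM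
  have hM1 : 1 ≤ M := by simpa using hMpow 0 (by omega)
  have hMd : M ≤ M ^ d := le_self_pow₀ hM1 (by omega)
  have hMd1 : 1 ≤ M ^ d := hM1.trans hMd
  have hMd0 : 0 < M ^ d := by linarith
  -- The lower bound makes CA/L₀ at most L₀^(-1/2). The upper bound keeps K = L₀^C below A^(3C),
  -- hence q ≤ K within the allowed range A^k.
  obtain ⟨L₀, hL₀c, hL₀A⟩ : ∃ L₀ : ℕ, ((C : ℝ) * A) ^ 2 ≤ L₀ ∧ (L₀ : ℝ) ≤ A ^ 3 := by
    refine ⟨⌈((C : ℝ) * A) ^ 2⌉₊, Nat.le_ceil _, ?_⟩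
    have h1 := Nat.ceil_lt_add_one (sq_nonneg ((C : ℝ) * A))
    have h2 : (1 : ℝ) ≤ ((C : ℝ) * A) ^ 2 :=
      one_le_pow₀ (one_le_mul_of_one_le_of_one_le hCr hA1)
    have h3 : 2 * (C : ℝ) ^ 2 * A ^ 2 ≤ A * A ^ 2 := by gcongr
    calc (⌈((C : ℝ) * A) ^ 2⌉₊ : ℝ) ≤ 2 * ((C : ℝ) * A) ^ 2 := by linarith
      _ = 2 * (C : ℝ) ^ 2 * A ^ 2 := by ring
      _ ≤ A * A ^ 2 := h3
      _ = A ^ 3 := by ring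
  have hAL₀ : A ^ 2 ≤ L₀ := by
    refine le_trans ?_ hL₀c
    gcongr
    exact le_mul_of_one_le_left hA0.le hCr
  have hL₀1' : (1 : ℝ) ≤ L₀ := (one_le_pow₀ hA1).trans hAL₀
  have hL₀1 : 1 ≤ L₀ := by exact_mod_cast hL₀1'
  set K : ℕ := L₀ ^ C with hK
  have hK1 : 1 ≤ K := Nat.one_le_pow _ _ hL₀1
  have hK0 : (0 : ℝ) < K := by exact_mod_cast hK1
  have hKA : (K : ℝ) ≤ A ^ (3 * C) := by
    rw [hK, pow_mul]
    push_cast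
    gcongr
  have hKpow : ∀ n m : ℕ, 3 * C * n ≤ m → (K : ℝ) ^ n ≤ A ^ m := fun n m h =>
    (pow_le_pow_left₀ hK0.le hKA n).trans (by rw [← pow_mul]; exact hApow _ _ h)
  have hboxpos : 0 < (box r k M).card := by
    rw [box, Fintype.card_piFinset_const]
    exact pow_pos (card_piFinset_interval_pos hM1) k
  set V : ℝ := C₂ * A * M ^ (d - 1) with hV
  set Y : ℝ := M ^ d / A ^ (2 * k) with hY
  have hY0 : 0 ≤ Y := by positivity
  have hVM : V * M = C₂ * A * M ^ d := by
    rw [hV, mul_assoc, ← pow_succ, Nat.sub_add_cancel hd]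
  have hVK : V * (K / M ^ d) ≤ 1 / (2 * K) := by
    have h1 : V * (K / M ^ d) = C₂ * A * K / M := by
      rw [eq_div_iff hM0.ne', mul_right_comm, hVM]
      field_simp
    rw [h1, div_le_div_iff₀ hM0 (by positivity)]
    calc C₂ * A * K * (2 * K) = 2 * C₂ * A * (K : ℝ) ^ 2 := by ring
      _ ≤ A * A * A ^ (6 * C) := by
          gcongr
          exact hKpow 2 _ (by omega)
      _ = A ^ (6 * C + 2) := by ring
      _ ≤ 1 * M := by rw [one_mul]; exact hMpow _ (by omega)
  have hKY : K * Y ≤ M ^ d := by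
    rw [hY, mul_div_assoc', div_le_iff₀ (by positivity), mul_comm]
    gcongr
    simpa using hKpow 1 (2 * k) (by omega)
  set X : ℕ := ⌈(k * C₂ * A + 1) * M ^ d⌉₊ with hX
  have hXle : k * (V * M) + K * Y ≤ X := by
    refine le_trans ?_ (Nat.le_ceil _)
    rw [hVM]
    linarith
  have hN : ((2 * X + 1 : ℕ) : ℝ) ≤ R₀ * A * M ^ d := by
    have h1 := Nat.ceil_lt_add_one (show 0 ≤ (k * C₂ * A + 1) * M ^ d by positivity)
    have h2 : 1 ≤ A * M ^ d := one_le_mul_of_one_le_of_one_le hA1 hMd1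
    have h3 : M ^ d ≤ A * M ^ d := le_mul_of_one_le_left hMd0.le hA1
    have h4 : R₀ * A * M ^ d = 2 * (k * C₂ * A * M ^ d) + 5 * (A * M ^ d) := by rw [hR₀]; ring
    push_cast
    rw [h4]
    linarith
  have hR1 : 1 ≤ R₀ * A := by
    have : 1 ≤ R₀ := by rw [hR₀]; linarith [(by positivity : 0 ≤ 2 * (k : ℝ) * C₂)]
    exact one_le_mul_of_one_le_of_one_le this hA1
  have hR₀0 : 0 < R₀ := by positivity
  have hweyl' : ∀ L : ℕ, 1 ≤ L → (L : ℝ) ^ C ≤ M → ∀ θ : ℝ,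
      (∀ q : ℕ, 1 ≤ q → q ≤ L ^ C → (L : ℝ) ^ C / M ^ d < distInt (q * θ)) →
      ∀ j, ∑ x ∈ Fintype.piFinset fun _ : Fin r => interval 1 M,
        dirichlet M ((MvPolynomial.eval x (P j) : ℤ) * θ) ^ 2
        ≤ C * A / L * (Fintype.piFinset fun _ : Fin r => interval 1 M).card :=
    fun L hL hLM θ hθ j => hweyl A (P j) hA1 (hP j).1 (hP j).2.1 (hP j).2.2 M θ L hL hLM hθ
  have hL₀M : (L₀ : ℝ) ^ C ≤ M := by
    have := hKpow 1 (3 * C) (by omega)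
    rw [hK] at this
    push_cast at this
    rw [pow_one] at this
    exact this.trans (hMpow _ (by omega))
  set N : ℕ := 2 * X + 1 with hNdef
  set m : (Fin k → Fin r → ℤ) → ℝ := fun h => ∑ ξ ∈ Finset.range N \ majorArcs N K (M ^ d),
    ∏ j, dirichlet M ((MvPolynomial.eval (h j) (P j) : ℤ) * (ξ / N)) ^ 2 with hm
  set E : ℝ := (majorArcs N K (M ^ d)).card *
    ((2 * Real.pi * Y * (K * (K / M ^ d))) ^ 2 + 4 * (K / M) ^ 2) with hE
  -- For K < l ≤ K² and q ≤ K, q/l is at least 1/K² from the integers. This exceeds K/M^d, so the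
  -- Weyl estimate of level L₀ applies at 1/l.
  have hbadcard := card_common_divisor_le (P := P) (K := K) (δ := C * A / L₀) hM0.le
    (by positivity) (fun j l hl hl2 => hweyl' L₀ hL₀1 hL₀M _ (fun q hq1 hq2 => by
      have := lt_distInt_mul_one_div (W := M ^ d) (lt_of_lt_of_le (lt_of_le_of_lt
        (hKpow 3 (9 * C) (by omega)) (pow_lt_pow_right₀ (by linarith) (Nat.lt_succ_self _)))
        ((hMpow (9 * C + 1) (by omega)).trans hMd)) hl hl2 hq1 hq2
      rw [hK] at this
      push_cast at this
      exact this) j)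
  have hbad : (K : ℝ) ^ 2 * (C * A / L₀) ^ k ≤ A⁻¹ := by
    have h1 := div_pow_le (s := 2 * C + 1) (k := k) (by positivity) hL₀c hL₀1 le_rfl (by
      have : 0 ≤ C * d := Nat.zero_le _
      omega)
    calc (K : ℝ) ^ 2 * (C * A / L₀) ^ k
        ≤ (L₀ : ℝ) ^ (2 * C) * (1 / (L₀ : ℝ)) ^ (2 * C + 1) := by
          rw [hK]
          push_cast
          rw [← pow_mul, mul_comm C 2]
          gcongr
      _ = 1 / (L₀ : ℝ) := by
          rw [pow_succ, ← mul_assoc, ← mul_pow, mul_one_div_cancel (by linarith), one_pow, one_mul]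
      _ ≤ A⁻¹ := by
          rw [one_div]
          gcongr
          nlinarith
  have hmsum : ∑ h ∈ box r k M, m h
      ≤ 13 * (R₀ * A) * 2 ^ (3 * C + C * d) / (L₀ : ℝ) ^ 2 * (box r k M).card := by
    rw [hm, Finset.sum_comm]
    exact sum_minorArcs_le (by positivity) hC hL₀c hL₀1 hL₀M hR1 hN hk hweyl'
  set f : (Fin k → Fin r → ℤ) → ℝ := fun h => ⨅ q : {q : ℕ // 1 ≤ q ∧ (q : ℝ) ≤ A ^ k},
    tvDist (polyProgression P M h)
      (sumMultiset (polyProgression P M h) (dilate ((q : ℕ) : ℤ) (interval (-Y) Y).val)) with hf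
  have hfle : ∀ h (q : ℕ), 1 ≤ q → (q : ℝ) ≤ A ^ k → f h ≤ tvDist (polyProgression P M h)
      (sumMultiset (polyProgression P M h) (dilate (q : ℤ) (interval (-Y) Y).val)) := by
    intro h q hq1 hq2
    refine ciInf_le (f := fun q : {q : ℕ // 1 ≤ q ∧ (q : ℝ) ≤ A ^ k} =>
      tvDist (polyProgression P M h) (sumMultiset (polyProgression P M h)
        (dilate ((q : ℕ) : ℤ) (interval (-Y) Y).val))) ⟨0, ?_⟩ ⟨q, hq1, hq2⟩
    rintro _ ⟨q, rfl⟩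
    exact tvDist_nonneg _ _
  have hf2 : ∀ h, f h ≤ 2 := fun h =>
    (hfle h 1 le_rfl (by simpa using one_le_pow₀ hA1)).trans (tvDist_le_two _ _)
  have hgood : ∀ h ∈ box r k M, (¬ ∃ l : ℕ, K < l ∧ l ≤ K ^ 2 ∧
      ∀ j, (l : ℤ) ∣ MvPolynomial.eval (h j) (P j)) → ∃ t : ℝ, f h ≤ t ∧ t ^ 2 ≤ 4 * m h + E := by
    intro h hh hp
    obtain ⟨q, hq1, hqK, hq⟩ := exists_tvDist_sq_le (a := fun j => MvPolynomial.eval (h j) (P j))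
      (V := V) (W := M ^ d) hM0 hY0 hK1 (fun l hl hl2 hdvd => hp ⟨l, hl, hl2, hdvd⟩)
      (abs_eval_le_of_mem_box hM1 (fun j => (hP j).2.1) (fun j => (hP j).2.2) hh) hVK hXle
    have h1 : (q : ℝ) ≤ K := by exact_mod_cast hqK
    exact ⟨_, hfle h q hq1 (h1.trans (by simpa using hKpow 1 k (by omega))), hq⟩
  have hm0 : ∀ h, 0 ≤ m h := fun h =>
    Finset.sum_nonneg fun ξ _ => Finset.prod_nonneg fun j _ => sq_nonneg _
  have hE0 : 0 ≤ E := by positivity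
  have havg := expect_le_of_forall_le hboxpos hA0 hm0 hE0 (fun h _ _ => hf2 h) hgood
    hbadcard hmsum
  refine havg.trans ?_
  have hAinv : 0 < A⁻¹ := inv_pos.2 hA0
  have hterm1 : 2 * A * (13 * (R₀ * A) * 2 ^ (3 * C + C * d) / (L₀ : ℝ) ^ 2)
      ≤ 26 * R₀ * 2 ^ (3 * C + C * d) * A⁻¹ := by
    have h1 : A ^ 3 ≤ (L₀ : ℝ) ^ 2 := by
      calc A ^ 3 ≤ (A ^ 2) ^ 2 := by rw [← pow_mul]; exact hApow _ _ (by norm_num)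
        _ ≤ _ := by gcongr
    calc 2 * A * (13 * (R₀ * A) * 2 ^ (3 * C + C * d) / (L₀ : ℝ) ^ 2)
        ≤ 2 * A * (13 * (R₀ * A) * 2 ^ (3 * C + C * d) / A ^ 3) := by gcongr
      _ = _ := by field_simp; norm_num
  have hterm2 : A * E / 2 ≤ 132 * R₀ * A⁻¹ := by
    have h1 := card_majorArcs_le (N := N) hMd0 hK1 hR1 hN
    have h2 : (2 * Real.pi * Y * (K * (K / M ^ d))) ^ 2 ≤ 40 * ((K : ℝ) ^ 4 / A ^ (4 * k)) := by
      have h3 : (2 * Real.pi * Y * (K * (K / M ^ d))) ^ 2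
          = (2 * Real.pi) ^ 2 * ((K : ℝ) ^ 4 / A ^ (4 * k)) := by
        rw [hY, show 4 * k = 2 * k * 2 by ring, pow_mul A (2 * k) 2]
        field_simp
      rw [h3]
      gcongr
      exact two_pi_sq_le
    -- K³ counts the arcs and K⁴ comes from the squared error; the shortness A^(-2k) of Q₀, squared,
    -- wins because 4k ≥ 21C + 3.
    have h4 : (K : ℝ) ^ 7 / A ^ (4 * k) ≤ 1 / A ^ 3 := by
      rw [div_le_div_iff₀ (by positivity) (by positivity), one_mul]
      calc (K : ℝ) ^ 7 * A ^ 3 ≤ A ^ (21 * C) * A ^ 3 := by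
            gcongr
            exact hKpow 7 _ (by omega)
        _ ≤ A ^ (4 * k) := by
            rw [← pow_add]
            exact hApow _ _ (by
              have : 0 ≤ C * d := Nat.zero_le _
              omega)
    have h5 : (K : ℝ) ^ 5 / M ^ 2 ≤ 1 / A ^ 3 := by
      rw [div_le_div_iff₀ (by positivity) (by positivity), one_mul]
      calc (K : ℝ) ^ 5 * A ^ 3 ≤ A ^ (15 * C) * A ^ 3 := by
            gcongr
            exact hKpow 5 _ (by omega)
        _ ≤ M := by
            rw [← pow_add]
            exact hMpow _ (by omega)
        _ ≤ M ^ 2 := le_self_pow₀ hM1 (by norm_num)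
    have h6 : E ≤ 6 * (R₀ * A) * K ^ 3 * (40 * ((K : ℝ) ^ 4 / A ^ (4 * k)) + 4 * (K / M) ^ 2) := by
      rw [hE]
      gcongr
    have h7 : 6 * (R₀ * A) * K ^ 3 * (40 * ((K : ℝ) ^ 4 / A ^ (4 * k)) + 4 * (K / M) ^ 2)
        = 6 * (R₀ * A) * (40 * ((K : ℝ) ^ 7 / A ^ (4 * k)) + 4 * ((K : ℝ) ^ 5 / M ^ 2)) := by
      rw [div_pow]
      ring
    have h8 : E ≤ 6 * (R₀ * A) * (40 * (1 / A ^ 3) + 4 * (1 / A ^ 3)) := by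
      rw [h7] at h6
      exact h6.trans (by gcongr)
    calc A * E / 2 ≤ A * (6 * (R₀ * A) * (40 * (1 / A ^ 3) + 4 * (1 / A ^ 3))) / 2 := by gcongr
      _ = 132 * R₀ * A⁻¹ := by field_simp; norm_num
  linarith
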